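/- Let $\mathscr H$ be a real or complex Hilbert space and $\mathbf H$ a (possibly unbounded) self-adjoint operator on $\mathscr H$ with spectral resolution $P$ (a projection-valued measure on $\mathbb R$ with $\mathbf H=\int E\,dP(E)$; point and continuous spectrum are both allowed). Let $v_1,\dots,v_M\in\operatorname{dom}\mathbf H$ and let $\mathbf V x=\sum_l x_l v_l$. For a Borel set $I\subseteq\mathbb R$ let $\mathbf V I=P(I)\mathbf V$, and for any such $\mathbf W$ write $\mathbf W^2=\mathbf W^\dagger \mathbf W$ for the Gram matrix and $\lambda_1(\mathbf W^2)\ge\lambda_2(\mathbf W^2)\ge\cdots$ for its eigenvalues. Let $m=\operatorname{rank}\mathbf V^2$. The proper eigenvalues $\mu_1(\mathbf V)\ge\dots\ge\mu_m(\mathbf V)$ of the generalized eigenvalue problem (GEP) $\mathbf V^\dagger\mathbf H\mathbf V x=\mu\,\mathbf V^\dagger\mathbf V x$ are those with eigenvectors outside $\ker\mathbf V$, with multiplicity; $\mu_i(\mathbf V):=0$ for $i>m$ (and likewise for other guess vectors). The spectral measure $|\alpha(E)|^2dE$ of the GEP is the measure $I\mapsto\operatorname{Tr}[(\mathbf V I)^2]=\sum_l\|P(I)v_l\|^2$.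 Let $E_a<E_b$, $\mathbf B=\mathbf V(E_a,E_b)$ and $\mathbf N=\mathbf V-\mathbf B$. Integrals $\int_{E_b}^\infty$ and $\int_{-\infty}^{E_a}$ are over the closed half-lines $[E_b,\infty)$ and $(-\infty,E_a]$. The GEP is a \emph{signal} to $(E_a,E_b)$ if $$\int_{E_b}^{\infty}\frac{|\alpha(E)|^2}{\lambda_{*}(\mathbf V(-\infty,E)^2)}dE\le1,\qquad \int_{-\infty}^{E_a}\frac{|\alpha(E)|^2}{\lambda_{*}(\mathbf V(E,\infty)^2)}dE\le1,$$ where $\lambda_*$ denotes the smallest non-zero eigenvalue ($\lambda_*=0$ for the zero matrix, with $1/0=\infty$). A signal is \emph{certifiable} if the quotients $$\frac{\int_{E_b}^\infty|\alpha(E)|^2dE}{\lambda_m(\mathbf V^2)-\lambda_1(\mathbf V[E_b,\infty)^2)},\qquad \frac{\int_{-\infty}^{E_a}|\alpha(E)|^2dE}{\lambda_m(\mathbf V^2)-\lambda_1(\mathbf V(-\infty,E_a]^2)}$$ are well defined (non-zero denominators) and lie in $[0,1]$. (i) If the GEP is a certifiable signal to $(E_a,E_b)$, then for all $1\le i\le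 m$ the integrals below converge and $$\frac{\int_{-\infty}^{E_a}(E-\mu_i(\mathbf B))|\alpha(E)|^2dE}{\lambda_m(\mathbf V^2)-\lambda_1(\mathbf V(-\infty,E_a]^2)}\ \le\ \mu_i(\mathbf V)-\mu_i(\mathbf B)\ \le\ \frac{\int_{E_b}^{\infty}(E-\mu_i(\mathbf B))|\alpha(E)|^2dE}{\lambda_m(\mathbf V^2)-\lambda_1(\mathbf V[E_b,\infty)^2)}.$$ (ii) If $\mathbf V\ne0$ and $\lambda_m(\mathbf V^2)\ge(m+1)\lambda_1(\mathbf N^2)$, then the GEP is a certifiable signal to $(E_a,E_b)$. (iii) (Guarantee R3.) Let $\mathcal E$ be the span of all eigenvectors of $\mathbf H$ with eigenvalues in $(E_a,E_b)$ and suppose that $\mathcal E=\operatorname{ran}P(E_a,E_b)$ (there is no continuous spectrum in the interval). Let $\varepsilon>\lambda_1(\mathbf N^2)$, let $\mathbf U=[u_1,\dots,u_M]$ be unitary with $\mathbf U^\dagger\mathbf V^2\mathbf U=\operatorname{diag}(\lambda_1(\mathbf V^2),\dots,\lambda_M(\mathbf V^2))$, and let $d$ be the number of eigenvalues of $\mathbf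 V^2$ (with multiplicity) that are at least $\varepsilon$. Let $\mathbf V_*=[\mathbf Vu_1,\dots,\mathbf Vu_d]$, with noise $\mathbf N_*=\mathbf V_*-\mathbf V_*(E_a,E_b)$ and spectral measure $|\alpha_*(E)|^2dE$. If $d=\dim\mathcal E$ and $\lambda_d(\mathbf V^2)\ge(d+1)\lambda_1(\mathbf N^2)$, then, with $\lambda_1\ge\dots\ge\lambda_d$ the eigenvalues of $\mathbf H$ in $\mathcal E$ counted with multiplicity, for all $1\le i\le d$ the integrals below converge and $$\frac{\int_{-\infty}^{E_a}(E-\lambda_i)|\alpha_*(E)|^2dE}{\lambda_d(\mathbf V^2)-\lambda_1(\mathbf N^2)}\ \le\ \mu_i(\mathbf V_*)-\lambda_i\ \le\ \frac{\int_{E_b}^{\infty}(E-\lambda_i)|\alpha_*(E)|^2dE}{\lambda_d(\mathbf V^2)-\lambda_1(\mathbf N^2)},$$ and $\int_{-\infty}^{E_a}|\alpha_*(E)|^2dE+\int_{E_b}^\infty|\alpha_*(E)|^2dE=\operatorname{Tr}[\mathbf N_*^2]\le d\,\lambda_1(\mathbf N^2)$. -/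

import Mathlib

open MeasureTheory Matrix
open scoped ENNReal InnerProductSpace

set_option linter.unusedSectionVars false

noncomputable section

namespace GEP

/-- A projection-valued measure on the Borel sets of `ℝ`, acting on the Hilbert space `ℋ`:
a resolution of the identity. -/
structure ProjValuedMeasure (𝕜 ℋ : Type*) [RCLike 𝕜] [NormedAddCommGroup ℋ]
    [InnerProductSpace 𝕜 ℋ] [CompleteSpace ℋ] where
  proj : Set ℝ → (ℋ →L[𝕜] ℋ)
  isStarProjection : ∀ S, MeasurableSet S → IsStarProjection (proj S)
  empty : proj ∅ = 0
  univ : proj Set.univ = 1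
  inter : ∀ S T, MeasurableSet S → MeasurableSet T → proj (S ∩ T) = proj S * proj T
  iUnion : ∀ S : ℕ → Set ℝ, (∀ n, MeasurableSet (S n)) → Pairwise (Function.onFun Disjoint S) →
    ∀ x, HasSum (fun n => proj (S n) x) (proj (⋃ n, S n) x)

variable {𝕜 ℋ : Type*} [RCLike 𝕜] [NormedAddCommGroup ℋ] [InnerProductSpace 𝕜 ℋ]
  [CompleteSpace ℋ] {M : ℕ}

theorem ProjValuedMeasure.norm_sq_eq (P : ProjValuedMeasure 𝕜 ℋ) {S : Set ℝ}
    (hS : MeasurableSet S) (x : ℋ) : ‖P.proj S x‖ ^ 2 = RCLike.re (inner 𝕜 x (P.proj S x)) := by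
  have h := P.isStarProjection S hS
  have hid : P.proj S (P.proj S x) = P.proj S x := by
    have := congrArg (fun T : ℋ →L[𝕜] ℋ => T x) h.isIdempotentElem.eq
    simpa using this
  have hsa := h.isSelfAdjoint
  rw [ContinuousLinearMap.isSelfAdjoint_iff_isSymmetric] at hsa
  have h2 : inner 𝕜 (P.proj S x) (P.proj S x) = inner 𝕜 x (P.proj S (P.proj S x)) :=
    hsa x (P.proj S x)
  rw [← inner_self_eq_norm_sq (𝕜 := 𝕜), h2, hid]

/-- The scalar measure `S ↦ ‖P(S) x‖² = ⟨x, P(S) x⟩`. -/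
def ProjValuedMeasure.measure (P : ProjValuedMeasure 𝕜 ℋ) (x : ℋ) : Measure ℝ :=
  Measure.ofMeasurable (fun S _ => ENNReal.ofReal (‖P.proj S x‖ ^ 2)) (by simp [P.empty]) (by
    intro S hS hd
    have hs : HasSum (fun n => ‖P.proj (S n) x‖ ^ 2) (‖P.proj (⋃ n, S n) x‖ ^ 2) := by
      rw [P.norm_sq_eq (MeasurableSet.iUnion hS)]
      simp_rw [fun n => P.norm_sq_eq (hS n) x]
      exact ((P.iUnion S hS hd x).mapL (innerSL 𝕜 x)).mapL (RCLike.reCLM (K := 𝕜))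
    rw [← hs.tsum_eq, ENNReal.ofReal_tsum_of_nonneg (fun n => by positivity) hs.summable])

theorem ProjValuedMeasure.measure_apply (P : ProjValuedMeasure 𝕜 ℋ) (x : ℋ) {S : Set ℝ}
    (hS : MeasurableSet S) : P.measure x S = ENNReal.ofReal (‖P.proj S x‖ ^ 2) :=
  Measure.ofMeasurable_apply S hS

theorem ProjValuedMeasure.measure_proj (P : ProjValuedMeasure 𝕜 ℋ) (x : ℋ) {S : Set ℝ}
    (hS : MeasurableSet S) : P.measure (P.proj S x) = (P.measure x).restrict S := by
  ext T hT
  rw [Measure.restrict_apply hT, P.measure_apply _ hT, P.measure_apply _ (hT.inter hS),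
    P.inter T S hT hS]
  rfl

/-- `P` is the spectral resolution of the (possibly unbounded) operator `H`, that is
`H = ∫ E dP(E)`: the domain of `H` consists of the `x` with `∫ E² d⟨x, P(E) x⟩ < ∞`, and
`⟨x, H x⟩ = ∫ E d⟨x, P(E) x⟩` on it. -/
structure IsSpectralResolution (H : ℋ →ₗ.[𝕜] ℋ) (P : ProjValuedMeasure 𝕜 ℋ) : Prop where
  mem_domain_iff : ∀ x, x ∈ H.domain ↔ ∫⁻ E, ENNReal.ofReal (E ^ 2) ∂P.measure x < ∞
  inner_apply : ∀ x : H.domain,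
    inner 𝕜 (x : ℋ) (H x) = ((∫ E, E ∂P.measure (x : ℋ) : ℝ) : 𝕜)

theorem IsSpectralResolution.proj_mem {H : ℋ →ₗ.[𝕜] ℋ} {P : ProjValuedMeasure 𝕜 ℋ}
    (hP : IsSpectralResolution H P) {S : Set ℝ} (hS : MeasurableSet S) {x : ℋ}
    (hx : x ∈ H.domain) : P.proj S x ∈ H.domain := by
  rw [hP.mem_domain_iff] at hx ⊢
  rw [P.measure_proj x hS]
  exact (lintegral_mono' Measure.restrict_le_self le_rfl).trans_lt hx

/-- The guess vectors `V I` projected onto the spectral subspace of a set `I` of energies. -/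
def restrictTo (P : ProjValuedMeasure 𝕜 ℋ) (I : Set ℝ) (v : Fin M → ℋ) : Fin M → ℋ :=
  fun l => P.proj I (v l)

/-- The signal part `B = V(E_a, E_b)` of guess vectors in the domain of `H`. -/
def signal {H : ℋ →ₗ.[𝕜] ℋ} {P : ProjValuedMeasure 𝕜 ℋ} (hP : IsSpectralResolution H P)
    (Ea Eb : ℝ) (v : Fin M → H.domain) : Fin M → H.domain :=
  fun l => ⟨P.proj (Set.Ioo Ea Eb) (v l), hP.proj_mem measurableSet_Ioo (v l).2⟩

/-- The noise part `N = V - B`. -/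
def noise (P : ProjValuedMeasure 𝕜 ℋ) (Ea Eb : ℝ) (v : Fin M → ℋ) : Fin M → ℋ :=
  fun l => v l - P.proj (Set.Ioo Ea Eb) (v l)

variable (𝕜) in
/-- `λ_k(V²)`: the `k`-th largest eigenvalue (`k = 1, …, M`, with multiplicity) of the Gram
matrix `V² = V†V` of the guess vectors, and `0` for all other `k`. -/
def gramEig (v : Fin M → ℋ) (k : ℕ) : ℝ :=
  if h : 1 ≤ k ∧ k ≤ M then
    (isHermitian_gram 𝕜 v).eigenvalues₀ ⟨k - 1, by rw [Fintype.card_fin]; omega⟩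
  else 0

variable (𝕜) in
/-- The rank of the Gram matrix `V²`. -/
def gramRank (v : Fin M → ℋ) : ℕ := (gram 𝕜 v).rank

variable (𝕜) in
/-- `λ_{m*}(V²)`: the smallest non-zero eigenvalue of the Gram matrix (`0` if `V = 0`). -/
def lowestGramEig (v : Fin M → ℋ) : ℝ := gramEig 𝕜 v (gramRank 𝕜 v)

/-- The spectral measure `|α(E)|² dE` of the guess vectors: the measure
`I ↦ Tr[(V I)²] = ∑ l, ‖P(I) v_l‖²`. -/
def specMeasure (P : ProjValuedMeasure 𝕜 ℋ) (v : Fin M → ℋ) : Measure ℝ :=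
  ∑ l, P.measure (v l)

/-- The matrix `V† H V`. -/
def projMatrix (H : ℋ →ₗ.[𝕜] ℋ) (v : Fin M → H.domain) : Matrix (Fin M) (Fin M) 𝕜 :=
  Matrix.of fun i j => inner 𝕜 (v i : ℋ) (H (v j))

/-- The Gram matrix `V†V` of guess vectors in the domain of `H`. -/
def gramMatrix (H : ℋ →ₗ.[𝕜] ℋ) (v : Fin M → H.domain) : Matrix (Fin M) (Fin M) 𝕜 :=
  gram 𝕜 fun l => (v l : ℋ)

/-- `μ` is the list of proper eigenvalues of the GEP `V†HV x = μ V†V x`, in descending order and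
with multiplicity: there are as many as the rank of `V†V`, with `V†V`-orthonormal eigenvectors. -/
def IsProperSpectrum (H : ℋ →ₗ.[𝕜] ℋ) (v : Fin M → H.domain)
    (μ : Fin (gramRank 𝕜 fun l => (v l : ℋ)) → ℝ) : Prop :=
  Antitone μ ∧ ∃ x : Fin (gramRank 𝕜 fun l => (v l : ℋ)) → Fin M → 𝕜,
    (∀ i, projMatrix H v *ᵥ x i = (μ i : 𝕜) • (gramMatrix H v *ᵥ x i)) ∧
    ∀ i j, star (x i) ⬝ᵥ (gramMatrix H v *ᵥ x j) = if i = j then 1 else 0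

theorem gram_mulVec (v : Fin M → ℋ) (x : Fin M → 𝕜) (i : Fin M) :
    (gram 𝕜 v *ᵥ x) i = inner 𝕜 (v i) (∑ l, x l • v l) := by
  simp [mulVec, dotProduct, inner_sum, inner_smul_right, gram_apply, mul_comm]

theorem star_dotProduct_gram (v : Fin M → ℋ) (x y : Fin M → 𝕜) :
    star x ⬝ᵥ (gram 𝕜 v *ᵥ y) = inner 𝕜 (∑ l, x l • v l) (∑ l, y l • v l) := by
  simp only [dotProduct, gram_mulVec, sum_inner, inner_smul_left, Pi.star_apply, RCLike.star_def]

theorem gramRank_eq (v : Fin M → ℋ) :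
    gramRank 𝕜 v = Module.finrank 𝕜 (Submodule.span 𝕜 (Set.range v)) := by
  have hker : LinearMap.ker (gram 𝕜 v).mulVecLin = LinearMap.ker (Fintype.linearCombination 𝕜 v) := by
    ext x
    simp only [LinearMap.mem_ker, mulVecLin_apply, Fintype.linearCombination_apply]
    constructor
    · intro h
      have h2 := star_dotProduct_gram v x x
      rw [h, dotProduct_zero] at h2
      exact inner_self_eq_zero.1 h2.symm
    · intro h
      ext i
      rw [gram_mulVec, h]
      simp
  have h1 := LinearMap.finrank_range_add_finrank_ker (gram 𝕜 v).mulVecLin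
  have h2 := LinearMap.finrank_range_add_finrank_ker (Fintype.linearCombination 𝕜 v)
  rw [hker] at h1
  rw [Fintype.range_linearCombination] at h2
  unfold gramRank Matrix.rank
  omega

/-- The generalized spectral theorem: the proper eigenvalues exist. -/
theorem exists_isProperSpectrum {H : ℋ →ₗ.[𝕜] ℋ} (hH : IsSelfAdjoint H) (v : Fin M → H.domain) :
    ∃ μ, IsProperSpectrum H v μ := by
  classical
  have hsymm : ∀ x y : H.domain, inner 𝕜 (H x) (y : ℋ) = inner 𝕜 (x : ℋ) (H y) := by
    have h := LinearPMap.adjoint_isFormalAdjoint hH.dense_domain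
    rw [LinearPMap.isSelfAdjoint_def.1 hH] at h
    exact h
  set w : Fin M → ℋ := fun l => (v l : ℋ) with hw
  set W : Submodule 𝕜 ℋ := Submodule.span 𝕜 (Set.range w) with hW
  have hWd : W ≤ H.domain := by
    rw [hW, Submodule.span_le]
    rintro _ ⟨l, rfl⟩
    exact (v l).2
  have : FiniteDimensional 𝕜 W := FiniteDimensional.span_of_finite 𝕜 (Set.finite_range w)
  let T : W →ₗ[𝕜] W :=
    (W.orthogonalProjectionOnto : ℋ →ₗ[𝕜] W) ∘ₗ H.toFun ∘ₗ Submodule.inclusion hWd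
  have hTapp : ∀ (z y : W), inner 𝕜 (z : ℋ) ((T y : W) : ℋ) =
      inner 𝕜 (z : ℋ) (H (Submodule.inclusion hWd y)) := by
    intro z y
    have : ((T y : W) : ℋ) = W.starProjection (H (Submodule.inclusion hWd y)) := rfl
    rw [this, ← Submodule.inner_starProjection_left_eq_right]
    rw [Submodule.starProjection_eq_self_iff.2 z.2]
  have hT : T.IsSymmetric := by
    intro y z
    have h1 := hTapp y z
    have h2 := hTapp z y
    rw [Submodule.coe_inner, Submodule.coe_inner, h1, ← inner_conj_symm, h2, inner_conj_symm]
    exact hsymm (Submodule.inclusion hWd y) (Submodule.inclusion hWd z)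
  have hn : Module.finrank 𝕜 W = gramRank 𝕜 w := (gramRank_eq w).symm
  have hex : ∀ i, ∃ x : Fin M → 𝕜, ∑ l, x l • w l = (hT.eigenvectorBasis hn i : ℋ) := by
    intro i
    have hmem : (hT.eigenvectorBasis hn i : ℋ) ∈
        LinearMap.range (Fintype.linearCombination 𝕜 w) := by
      rw [Fintype.range_linearCombination]
      exact (hT.eigenvectorBasis hn i).2
    obtain ⟨x, hx⟩ := hmem
    exact ⟨x, by simpa [Fintype.linearCombination_apply] using hx⟩
  choose x hx using hex
  refine ⟨hT.eigenvalues hn, hT.eigenvalues_antitone hn, x, ?_, ?_⟩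
  · intro i
    ext k
    have hsum : (∑ l, x i l • v l : H.domain) =
        Submodule.inclusion hWd (hT.eigenvectorBasis hn i) := by
      apply Subtype.ext
      rw [Submodule.coe_inclusion, ← hx i]
      simp [hw]
    have hL : (projMatrix H v *ᵥ x i) k = inner 𝕜 (w k) (H (∑ l, x i l • v l)) := by
      have : H (∑ l, x i l • v l) = ∑ l, x i l • H (v l) := by
        change H.toFun _ = _
        rw [map_sum]
        simp only [map_smul]
        rfl
      rw [this]
      simp [mulVec, dotProduct, inner_sum, inner_smul_right, projMatrix, mul_comm, hw]
    have hk : w k ∈ W := Submodule.subset_span ⟨k, rfl⟩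
    have h3 := hTapp ⟨w k, hk⟩ (hT.eigenvectorBasis hn i)
    rw [hT.apply_eigenvectorBasis hn i] at h3
    rw [hL, hsum, ← h3, Pi.smul_apply]
    have h4 : (gramMatrix H v *ᵥ x i) k = inner 𝕜 (w k) (∑ l, x i l • w l) := gram_mulVec w (x i) k
    rw [h4, hx i, Submodule.coe_smul, inner_smul_right, smul_eq_mul]
  · intro i j
    have h5 : star (x i) ⬝ᵥ (gramMatrix H v *ᵥ x j) =
      inner 𝕜 (∑ l, x i l • w l) (∑ l, x j l • w l) := star_dotProduct_gram w (x i) (x j)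
    rw [h5, hx i, hx j, ← Submodule.coe_inner]
    exact orthonormal_iff_ite.1 (hT.eigenvectorBasis hn).orthonormal i j

/-- `μ_k(V)`: the `k`-th largest proper eigenvalue of the GEP `(H, V)` for `k = 1, …, rank V²`.
The spurious eigenvalues (all other `k`) are set to zero. -/
def genEig {H : ℋ →ₗ.[𝕜] ℋ} (hH : IsSelfAdjoint H) (v : Fin M → H.domain) (k : ℕ) : ℝ :=
  if h : 1 ≤ k ∧ k ≤ gramRank 𝕜 (fun l => (v l : ℋ)) then
    (exists_isProperSpectrum hH v).choose ⟨k - 1, by omega⟩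
  else 0

/-- The GEP is a signal to `(E_a, E_b)`:
`∫_{E_b}^∞ |α(E)|² / λ_{m*}(V(-∞,E)²) dE ≤ 1` and
`∫_{-∞}^{E_a} |α(E)|² / λ_{m*}(V(E,∞)²) dE ≤ 1` (with `1 / 0 = ∞`). -/
def IsSignal (P : ProjValuedMeasure 𝕜 ℋ) (Ea Eb : ℝ) (v : Fin M → ℋ) : Prop :=
  ∫⁻ E in Set.Ici Eb, (ENNReal.ofReal (lowestGramEig 𝕜 (restrictTo P (Set.Iio E) v)))⁻¹
      ∂specMeasure P v ≤ 1 ∧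
  ∫⁻ E in Set.Iic Ea, (ENNReal.ofReal (lowestGramEig 𝕜 (restrictTo P (Set.Ioi E) v)))⁻¹
      ∂specMeasure P v ≤ 1

/-- `λ_m(V²) - λ_1(V[E_b,∞)²)`, where `m` is the rank of `V²`. -/
def upperGap (P : ProjValuedMeasure 𝕜 ℋ) (Eb : ℝ) (v : Fin M → ℋ) : ℝ :=
  gramEig 𝕜 v (gramRank 𝕜 v) - gramEig 𝕜 (restrictTo P (Set.Ici Eb) v) 1

/-- `λ_m(V²) - λ_1(V(-∞,E_a]²)`, where `m` is the rank of `V²`. -/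
def lowerGap (P : ProjValuedMeasure 𝕜 ℋ) (Ea : ℝ) (v : Fin M → ℋ) : ℝ :=
  gramEig 𝕜 v (gramRank 𝕜 v) - gramEig 𝕜 (restrictTo P (Set.Iic Ea) v) 1

/-- The GEP is a certifiable signal to `(E_a, E_b)`: a signal for which the two quotients below
are well defined and lie in `[0, 1]`. -/
structure IsCertifiable (P : ProjValuedMeasure 𝕜 ℋ) (Ea Eb : ℝ) (v : Fin M → ℋ) : Prop where
  isSignal : IsSignal P Ea Eb v
  upper_ne : upperGap P Eb v ≠ 0
  upper_mem : (specMeasure P v).real (Set.Ici Eb) / upperGap P Eb v ∈ Set.Icc (0 : ℝ) 1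
  lower_ne : lowerGap P Ea v ≠ 0
  lower_mem : (specMeasure P v).real (Set.Iic Ea) / lowerGap P Ea v ∈ Set.Icc (0 : ℝ) 1

/-- The span of all eigenvectors of `H` with eigenvalues in `(E_a, E_b)`. -/
def eigenSubspace (H : ℋ →ₗ.[𝕜] ℋ) (Ea Eb : ℝ) : Submodule 𝕜 ℋ :=
  Submodule.span 𝕜
    {φ | ∃ (x : H.domain) (t : ℝ), t ∈ Set.Ioo Ea Eb ∧ H x = (t : 𝕜) • (x : ℋ) ∧ (x : ℋ) = φ}

variable (𝕜) in
/-- The number of eigenvalues of the Gram matrix that are at least `ε`: the detected dimension. -/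
def detectedDim (v : Fin M → ℋ) (ε : ℝ) : ℕ :=
  (Finset.univ.filter fun j : Fin M => ε ≤ gramEig 𝕜 v (j + 1)).card

theorem detectedDim_le (v : Fin M → ℋ) (ε : ℝ) : detectedDim 𝕜 v ε ≤ M :=
  (Finset.card_le_univ _).trans_eq (Fintype.card_fin M)

/-- The matrix `U` diagonalizes the Gram matrix with eigenvalues in descending order. -/
def Diagonalizes (v : Fin M → ℋ) (U : Matrix (Fin M) (Fin M) 𝕜) : Prop :=
  U ∈ Matrix.unitaryGroup (Fin M) 𝕜 ∧
    Uᴴ * gram 𝕜 v * U = Matrix.diagonal fun j : Fin M => ((gramEig 𝕜 v (j + 1) : ℝ) : 𝕜)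

/-- The refined guess vectors `V u_1, …, V u_d`, where `u_j` are the columns of `U` and `d` is
the detected dimension. -/
def refined {H : ℋ →ₗ.[𝕜] ℋ} (v : Fin M → H.domain) (U : Matrix (Fin M) (Fin M) 𝕜) (ε : ℝ) :
    Fin (detectedDim 𝕜 (fun l => (v l : ℋ)) ε) → H.domain :=
  fun j => ∑ l, U l (Fin.castLE (detectedDim_le _ _) j) • v l

end GEP

end

/-! Everything rests on one min-max comparison. Let `e` be the Ritz vectors of the guess space with
values `μ`, and `w` a Ritz family inside the spectral subspace of the interval, with values `ν`,
whose span contains the projected guess vectors. A dimension count gives a nonzero `y` in the span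
of the first `i` vectors of `e`, orthogonal to the first `i - 1` vectors of `w`, so `(μ i - c) ‖y‖²`
is at most the integral of `E - c` against the spectral measure of `y`. For `c = ν i` the part below
`Ea` is nonpositive because `c ≥ Ea`, the part inside the interval is nonpositive by orthogonality,
and only the part above `Eb` remains. By Cauchy–Schwarz the measure of `y` is at most `‖y‖² / g`
times the spectral measure of the GEP whenever `g` bounds the nonzero Gram eigenvalues from below
(`smul_measure_le_specMeasure`). This is `mul_ritz_sub_le`; `le_mul_ritz_sub` is its mirror image.

For (i), `w` comes from the GEP of the signal part and `g` is the smallest nonzero Gram eigenvalue;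
the stated denominators are smaller, which only weakens the bounds. If the signal part has lower
rank, the missing `μ_i(B)` are set to zero and may lie outside the interval. Then both
certifiability quotients equal one (`gap_eq_of_proj_eq_zero`), and the constant `c` cancels from the
inequality.

For (ii), removing a tail lowers the smallest nonzero Gram eigenvalue by at most the largest
eigenvalue of the tail (`sub_le_lowestGramEig`), and the trace of a tail is at most the rank times
that eigenvalue. For (iii), `w` consists of the eigenvectors of `H` themselves, and the refined
vectors have a diagonal Gram matrix. -/

namespace GEP

variable {𝕜 ℋ : Type*} [RCLike 𝕜] [NormedAddCommGroup ℋ] [InnerProductSpace 𝕜 ℋ]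
  [CompleteSpace ℋ]

/-! ### Scalar spectral measures. -/

section ScalarMeasure

variable (P : ProjValuedMeasure 𝕜 ℋ)

theorem ProjValuedMeasure.measure_univ (x : ℋ) :
    P.measure x Set.univ = ENNReal.ofReal (‖x‖ ^ 2) := by
  rw [P.measure_apply x MeasurableSet.univ, P.univ]
  rfl

instance ProjValuedMeasure.isFiniteMeasure_measure (x : ℋ) : IsFiniteMeasure (P.measure x) :=
  ⟨by rw [P.measure_univ]; exact ENNReal.ofReal_lt_top⟩

theorem ProjValuedMeasure.real_apply (x : ℋ) {S : Set ℝ} (hS : MeasurableSet S) :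
    (P.measure x).real S = ‖P.proj S x‖ ^ 2 := by
  rw [Measure.real, P.measure_apply x hS, ENNReal.toReal_ofReal (by positivity)]

theorem ProjValuedMeasure.real_univ (x : ℋ) : (P.measure x).real Set.univ = ‖x‖ ^ 2 := by
  rw [Measure.real, P.measure_univ x, ENNReal.toReal_ofReal (by positivity)]

theorem ProjValuedMeasure.proj_idem {S : Set ℝ} (hS : MeasurableSet S) (x : ℋ) :
    P.proj S (P.proj S x) = P.proj S x := by
  have := congrArg (fun T : ℋ →L[𝕜] ℋ => T x) (P.isStarProjection S hS).isIdempotentElem.eq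
  simpa using this

theorem ProjValuedMeasure.inner_proj {S : Set ℝ} (hS : MeasurableSet S) (x y : ℋ) :
    inner 𝕜 (P.proj S x) y = inner 𝕜 x (P.proj S y) := by
  have hsa := (P.isStarProjection S hS).isSelfAdjoint
  rw [ContinuousLinearMap.isSelfAdjoint_iff_isSymmetric] at hsa
  exact hsa x y

theorem ProjValuedMeasure.norm_sq_compl {S : Set ℝ} (hS : MeasurableSet S) (x : ℋ) :
    ‖P.proj S x‖ ^ 2 + ‖P.proj Sᶜ x‖ ^ 2 = ‖x‖ ^ 2 := by
  rw [← P.real_apply x hS, ← P.real_apply x hS.compl, ← P.real_univ x]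
  exact measureReal_add_measureReal_compl hS

theorem ProjValuedMeasure.norm_sq_mono {S T : Set ℝ} (hS : MeasurableSet S) (hT : MeasurableSet T)
    (h : S ⊆ T) (x : ℋ) : ‖P.proj S x‖ ^ 2 ≤ ‖P.proj T x‖ ^ 2 := by
  rw [← P.real_apply x hS, ← P.real_apply x hT]
  exact measureReal_mono h

theorem ProjValuedMeasure.sub_proj {S : Set ℝ} (hS : MeasurableSet S) (x : ℋ) :
    x - P.proj S x = P.proj Sᶜ x := by
  -- The difference of the two sides is annihilated by both complementary projections, so its norm
  -- vanishes by Pythagoras.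
  have h2 := (P.norm_sq_compl hS (x - P.proj S x - P.proj Sᶜ x))
  have h0 : P.proj S (P.proj Sᶜ x) = 0 := by
    have := congrArg (fun T : ℋ →L[𝕜] ℋ => T x) (P.inter S Sᶜ hS hS.compl)
    simpa [P.empty] using this.symm
  have h0' : P.proj Sᶜ (P.proj S x) = 0 := by
    have := congrArg (fun T : ℋ →L[𝕜] ℋ => T x) (P.inter Sᶜ S hS.compl hS)
    simpa [P.empty] using this.symm
  have e1 : P.proj S (x - P.proj S x - P.proj Sᶜ x) = 0 := by
    simp [map_sub, h0, P.proj_idem hS]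
  have e2 : P.proj Sᶜ (x - P.proj S x - P.proj Sᶜ x) = 0 := by
    simp [map_sub, h0', P.proj_idem hS.compl]
  rw [e1, e2] at h2
  have h3 : x - P.proj S x - P.proj Sᶜ x = 0 := by
    simpa using h2.symm
  exact sub_eq_zero.1 h3

theorem integral_eq_add_Iic_Ioo_Ici {ρ : Measure ℝ} {Ea Eb : ℝ} (hE : Ea < Eb) {f : ℝ → ℝ}
    (hf : Integrable f ρ) :
    ∫ E, f E ∂ρ = ∫ E in Set.Iic Ea, f E ∂ρ + ∫ E in Set.Ioo Ea Eb, f E ∂ρ +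
      ∫ E in Set.Ici Eb, f E ∂ρ := by
  have h1 : Set.Iic Ea ∪ Set.Ioo Ea Eb = Set.Iio Eb := by
    ext t
    simp only [Set.mem_union, Set.mem_Iic, Set.mem_Ioo, Set.mem_Iio]
    constructor
    · rintro (h | h)
      · exact h.trans_lt hE
      · exact h.2
    · intro h
      rcases le_or_gt t Ea with h' | h'
      · exact Or.inl h'
      · exact Or.inr ⟨h', h⟩
  have hd : Disjoint (Set.Iic Ea) (Set.Ioo Ea Eb) :=
    Set.disjoint_left.2 fun t h h' => not_lt_of_ge h h'.1
  have hd' : Disjoint (Set.Iio Eb) (Set.Ici Eb) :=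
    Set.disjoint_left.2 fun t (h : t < Eb) h' => not_lt_of_ge h' h
  rw [← setIntegral_union hd measurableSet_Ioo hf.integrableOn hf.integrableOn, h1,
    ← setIntegral_union hd'
    measurableSet_Ici hf.integrableOn hf.integrableOn, Set.Iio_union_Ici, setIntegral_univ]

variable {P} {H : ℋ →ₗ.[𝕜] ℋ}

theorem IsSpectralResolution.integrable_id (hP : IsSpectralResolution H P) {x : ℋ}
    (hx : x ∈ H.domain) : Integrable (fun E => E) (P.measure x) := by
  have h := (hP.mem_domain_iff x).1 hx
  have h2 : Integrable (fun E : ℝ => E ^ 2) (P.measure x) := by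
    refine ⟨(by fun_prop : Measurable fun E : ℝ => E ^ 2).aestronglyMeasurable, ?_⟩
    rw [hasFiniteIntegral_iff_ofReal (by filter_upwards with E using sq_nonneg E)]
    exact h
  refine (h2.add (integrable_const 1)).mono' measurable_id.aestronglyMeasurable ?_
  filter_upwards with E
  rw [Real.norm_eq_abs, abs_le]
  simp only [Pi.add_apply]
  -- The bound is `|E| ≤ E² + 1`, integrable because the spectral measure is finite.
  constructor <;> nlinarith [sq_nonneg (E + 1), sq_nonneg (E - 1)]

theorem IsSpectralResolution.re_inner (hP : IsSpectralResolution H P) (x : H.domain) :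
    RCLike.re (inner 𝕜 (x : ℋ) (H x)) = ∫ E, E ∂P.measure (x : ℋ) := by
  rw [hP.inner_apply x, RCLike.ofReal_re]

theorem IsSpectralResolution.integral_sub (hP : IsSpectralResolution H P) {x : ℋ}
    (hx : x ∈ H.domain) (c : ℝ) :
    ∫ E, (E - c) ∂P.measure x = ∫ E, E ∂P.measure x - c * ‖x‖ ^ 2 := by
  rw [MeasureTheory.integral_sub (hP.integrable_id hx) (integrable_const c), integral_const,
    P.real_univ, smul_eq_mul, mul_comm]

end ScalarMeasure

/-! ### Ritz families. -/

/-- An orthonormal family in the domain of `H` that diagonalizes the compression of `H` to its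
span, with diagonal entries in descending order. -/
structure IsRitzFamily (H : ℋ →ₗ.[𝕜] ℋ) {n : ℕ} (e : Fin n → H.domain) (μ : Fin n → ℝ) :
    Prop where
  orthonormal : Orthonormal 𝕜 fun i => (e i : ℋ)
  inner_apply : ∀ i j, inner 𝕜 (e i : ℋ) (H (e j)) = if i = j then (μ j : 𝕜) else 0
  antitone : Antitone μ

namespace IsRitzFamily

variable {H : ℋ →ₗ.[𝕜] ℋ} {n : ℕ} {e : Fin n → H.domain} {μ : Fin n → ℝ}

theorem norm_sq_sum (he : IsRitzFamily H e μ) (a : Fin n → 𝕜) :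
    ‖∑ i, a i • (e i : ℋ)‖ ^ 2 = ∑ i, ‖a i‖ ^ 2 := by
  rw [← inner_self_eq_norm_sq (𝕜 := 𝕜), he.orthonormal.inner_sum]
  simp only [RCLike.conj_mul, map_sum]
  exact Finset.sum_congr rfl fun i _ => by rw [← RCLike.ofReal_pow, RCLike.ofReal_re]

theorem coe_sum (a : Fin n → 𝕜) : ((∑ i, a i • e i : H.domain) : ℋ) = ∑ i, a i • (e i : ℋ) := by
  simp

theorem integral_id {P : ProjValuedMeasure 𝕜 ℋ} (he : IsRitzFamily H e μ)
    (hP : IsSpectralResolution H P) (a : Fin n → 𝕜) :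
    ∫ E, E ∂P.measure (∑ i, a i • (e i : ℋ)) = ∑ i, ‖a i‖ ^ 2 * μ i := by
  have h := hP.re_inner (∑ i, a i • e i)
  have hH : H (∑ l, a l • e l) = ∑ l, a l • H (e l) := by
    change H.toFun _ = _
    rw [map_sum]
    simp only [map_smul]
    rfl
  rw [coe_sum] at h
  rw [← h, hH, sum_inner, map_sum]
  refine Finset.sum_congr rfl fun i _ => ?_
  rw [inner_smul_left, inner_sum]
  simp only [inner_smul_right, he.inner_apply, mul_ite, mul_zero, Finset.sum_ite_eq,
    Finset.mem_univ, if_true]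
  rw [← mul_assoc, RCLike.conj_mul, ← RCLike.ofReal_pow, ← RCLike.ofReal_mul, RCLike.ofReal_re]

/-- A nonzero combination of the vectors indexed by `s` that is orthogonal to fewer vectors. -/
theorem exists_orthogonal (he : IsRitzFamily H e μ) {r : ℕ} (w : Fin r → ℋ)
    (s : Finset (Fin n)) (t : Finset (Fin r)) (hst : t.card < s.card) :
    ∃ a : Fin n → 𝕜, (∀ i, i ∉ s → a i = 0) ∧ (∑ i, a i • (e i : ℋ)) ≠ 0 ∧
      ∀ j ∈ t, inner 𝕜 (w j) (∑ i, a i • (e i : ℋ)) = 0 := by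
  classical
  let f : (s → 𝕜) →ₗ[𝕜] (t → 𝕜) :=
    LinearMap.pi fun j => (innerSL 𝕜 (w j) : ℋ →ₗ[𝕜] 𝕜) ∘ₗ
      Fintype.linearCombination 𝕜 (fun i : s => (e i : ℋ))
  -- More unknown coefficients than orthogonality conditions.
  have hf : LinearMap.ker f ≠ ⊥ := LinearMap.ker_ne_bot_of_finrank_lt (by simpa using hst)
  obtain ⟨b, hb, hb0⟩ := Submodule.exists_mem_ne_zero_of_ne_bot hf
  let a : Fin n → 𝕜 := fun i => if h : i ∈ s then b ⟨i, h⟩ else 0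
  have hsum : ∑ i, a i • (e i : ℋ) = ∑ i : s, b i • (e i : ℋ) := by
    rw [← Finset.sum_subset (Finset.subset_univ s)
      (fun i _ hi => by simp [a, hi]), ← Finset.sum_coe_sort s]
    exact Finset.sum_congr rfl fun i _ => by simp [a]
  refine ⟨a, fun i hi => by simp [a, hi], ?_, ?_⟩
  · intro h0
    apply hb0
    have h1 := he.norm_sq_sum a
    rw [h0, norm_zero, zero_pow two_ne_zero] at h1
    have h2 := (Finset.sum_eq_zero_iff_of_nonneg (fun i _ => by positivity)).1 h1.symm
    ext i
    have := h2 i (Finset.mem_univ _)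
    simpa [a] using this
  · intro j hj
    rw [hsum]
    have := congrFun (LinearMap.mem_ker.1 hb) ⟨j, hj⟩
    simpa [f, Fintype.linearCombination_apply] using this

theorem eq_sum_of_mem_span (he : IsRitzFamily H e μ) {y : ℋ}
    (hy : y ∈ Submodule.span 𝕜 (Set.range fun i => (e i : ℋ))) :
    y = ∑ i, (inner 𝕜 (e i : ℋ) y) • (e i : ℋ) := by
  rw [← Fintype.range_linearCombination] at hy
  obtain ⟨a, rfl⟩ := hy
  rw [Fintype.linearCombination_apply]
  refine Finset.sum_congr rfl fun i _ => ?_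
  rw [he.orthonormal.inner_right_fintype]

/-- The diagonal entries lie in every interval that carries the spectral measures of the family. -/
theorem mem_Icc {P : ProjValuedMeasure 𝕜 ℋ} (he : IsRitzFamily H e μ)
    (hP : IsSpectralResolution H P) {Ea Eb : ℝ}
    (hproj : ∀ i, P.proj (Set.Ioo Ea Eb) (e i : ℋ) = e i) (i : Fin n) :
    μ i ∈ Set.Icc Ea Eb := by
  have h1 : ∫ E, E ∂P.measure (e i : ℋ) = μ i := by
    rw [← hP.re_inner, he.inner_apply, if_pos rfl, RCLike.ofReal_re]
  have hn : ‖(e i : ℋ)‖ = 1 := he.orthonormal.1 i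
  have hr : P.measure (e i : ℋ) = (P.measure (e i : ℋ)).restrict (Set.Ioo Ea Eb) := by
    rw [← P.measure_proj _ measurableSet_Ioo, hproj]
  -- The measure of the unit vector `e i` is a probability measure carried by the interval, and `μ
  -- i` is its mean.
  have hsub : ∀ c, μ i - c = ∫ E in Set.Ioo Ea Eb, (E - c) ∂P.measure (e i : ℋ) := by
    intro c
    rw [← hr, hP.integral_sub (e i).2, h1, hn]
    ring
  constructor
  · rw [← sub_nonneg, hsub]
    exact setIntegral_nonneg measurableSet_Ioo fun E hE => sub_nonneg.2 hE.1.le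
  · rw [← sub_nonpos, hsub]
    exact setIntegral_nonpos measurableSet_Ioo fun E hE => sub_nonpos.2 hE.2.le

end IsRitzFamily

/-! ### The min-max comparison of two Ritz families. -/

section Comparison

variable {H : ℋ →ₗ.[𝕜] ℋ} {P : ProjValuedMeasure 𝕜 ℋ} {Ea Eb : ℝ} {M n r : ℕ}
  {v : Fin M → H.domain} {e : Fin n → H.domain} {μ : Fin n → ℝ} {w : Fin r → H.domain}
  {ν : Fin r → ℝ} {g : ℝ}

/-- The vectors `y` of the span of `v` have coordinates `x` with `g ‖x‖² ≤ ‖y‖²`. -/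
def IsCoercive (𝕜 : Type*) {ℋ : Type*} [RCLike 𝕜] [NormedAddCommGroup ℋ] [InnerProductSpace 𝕜 ℋ]
    {M : ℕ} (v : Fin M → ℋ) (g : ℝ) : Prop :=
  ∀ y ∈ Submodule.span 𝕜 (Set.range v), ∃ x : Fin M → 𝕜,
    y = ∑ l, x l • v l ∧ g * ∑ l, ‖x l‖ ^ 2 ≤ ‖y‖ ^ 2

theorem norm_sum_smul_sq_le (x : Fin M → 𝕜) (u : Fin M → ℋ) :
    ‖∑ l, x l • u l‖ ^ 2 ≤ (∑ l, ‖x l‖ ^ 2) * ∑ l, ‖u l‖ ^ 2 := by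
  have h1 : ‖∑ l, x l • u l‖ ≤ ∑ l, ‖x l‖ * ‖u l‖ :=
    (norm_sum_le _ _).trans_eq (Finset.sum_congr rfl fun l _ => norm_smul _ _)
  calc ‖∑ l, x l • u l‖ ^ 2 ≤ (∑ l, ‖x l‖ * ‖u l‖) ^ 2 := by gcongr
    _ ≤ _ := Finset.sum_mul_sq_le_sq_mul_sq _ _ _

instance isFiniteMeasure_specMeasure (u : Fin M → ℋ) : IsFiniteMeasure (specMeasure P u) := by
  unfold specMeasure
  infer_instance

theorem specMeasure_real_apply (u : Fin M → ℋ) {S : Set ℝ} (hS : MeasurableSet S) :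
    (specMeasure P u).real S = ∑ l, ‖P.proj S (u l)‖ ^ 2 := by
  rw [Measure.real, specMeasure, Measure.finsetSum_apply,
    ENNReal.toReal_sum fun l _ => measure_ne_top _ _]
  exact Finset.sum_congr rfl fun l _ => P.real_apply _ hS

/-- Projecting `y = ∑ x l • u l` and applying Cauchy–Schwarz bounds its mass in `S` by `∑ ‖x l‖²`
times the total mass of the guess vectors in `S`; coercivity trades `g ∑ ‖x l‖²` for `‖y‖²`. -/
theorem smul_measure_le_specMeasure {u : Fin M → ℋ} (hg : 0 ≤ g) (hu : IsCoercive 𝕜 u g) {y : ℋ}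
    (hy : y ∈ Submodule.span 𝕜 (Set.range u)) :
    ENNReal.ofReal g • P.measure y ≤ ENNReal.ofReal (‖y‖ ^ 2) • specMeasure P u := by
  obtain ⟨x, hx, hxg⟩ := hu y hy
  refine Measure.le_iff.2 fun S hS => ?_
  rw [Measure.smul_apply, Measure.smul_apply, P.measure_apply y hS, smul_eq_mul, smul_eq_mul,
    ← ENNReal.ofReal_toReal (measure_ne_top (specMeasure P u) S), ← Measure.real,
    specMeasure_real_apply u hS, ← ENNReal.ofReal_mul hg, ← ENNReal.ofReal_mul (by positivity)]
  apply ENNReal.ofReal_le_ofReal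
  have h1 : ‖P.proj S y‖ ^ 2 ≤ (∑ l, ‖x l‖ ^ 2) * ∑ l, ‖P.proj S (u l)‖ ^ 2 := by
    rw [hx, map_sum]
    simp only [map_smul]
    exact norm_sum_smul_sq_le _ _
  calc g * ‖P.proj S y‖ ^ 2 ≤ g * ((∑ l, ‖x l‖ ^ 2) * ∑ l, ‖P.proj S (u l)‖ ^ 2) := by gcongr
    _ = (g * ∑ l, ‖x l‖ ^ 2) * ∑ l, ‖P.proj S (u l)‖ ^ 2 := by ring
    _ ≤ _ := by gcongr

theorem integrable_specMeasure (hP : IsSpectralResolution H P) (v : Fin M → H.domain) (c : ℝ) :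
    Integrable (fun E => E - c) (specMeasure P fun l => (v l : ℋ)) := by
  refine Integrable.sub ?_ (integrable_const c)
  unfold specMeasure
  rw [integrable_finsetSum_measure]
  exact fun l _ => hP.integrable_id (v l).2

theorem mul_setIntegral_le (hg : 0 ≤ g) {u : Fin M → ℋ} (hu : IsCoercive 𝕜 u g) {y : ℋ}
    (hy : y ∈ Submodule.span 𝕜 (Set.range u)) {S : Set ℝ} (hS : MeasurableSet S) {f : ℝ → ℝ}
    (hf : Integrable f (specMeasure P u)) (hf0 : ∀ E ∈ S, 0 ≤ f E) :
    g * ∫ E in S, f E ∂P.measure y ≤ ‖y‖ ^ 2 * ∫ E in S, f E ∂specMeasure P u := by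
  have hle := Measure.restrict_mono (le_refl S)
    (smul_measure_le_specMeasure (P := P) hg hu hy)
  rw [Measure.restrict_smul, Measure.restrict_smul] at hle
  have h := integral_mono_measure (f := f) hle ?_ ?_
  · rw [integral_smul_measure, integral_smul_measure, ENNReal.toReal_ofReal hg,
      ENNReal.toReal_ofReal (by positivity)] at h
    exact h
  · have h0 : ∀ᵐ E ∂(specMeasure P u).restrict S, 0 ≤ f E := by
      filter_upwards [ae_restrict_mem hS] with E hE using hf0 E hE
    exact Measure.ae_smul_measure h0 _
  · exact hf.restrict.smul_measure ENNReal.ofReal_ne_top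

theorem integral_Ioo_eq (hP : IsSpectralResolution H P) {y : ℋ} (hy : y ∈ H.domain) (c : ℝ) :
    ∫ E in Set.Ioo Ea Eb, (E - c) ∂P.measure y =
      ∫ E, E ∂P.measure (P.proj (Set.Ioo Ea Eb) y) - c * ‖P.proj (Set.Ioo Ea Eb) y‖ ^ 2 := by
  rw [← P.measure_proj y measurableSet_Ioo, hP.integral_sub (hP.proj_mem measurableSet_Ioo hy)]

/-- The projection of `y` expands in `w`, and its coefficients are those of `y` itself because the
projection is self-adjoint and fixes `w`. Orthogonality of `y` to some `w j` thus removes whole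
terms. -/
theorem integral_Ioo_eq_sum (hP : IsSpectralResolution H P) (hw : IsRitzFamily H w ν)
    (hwP : ∀ j, P.proj (Set.Ioo Ea Eb) (w j : ℋ) = w j) {y : ℋ} (hy : y ∈ H.domain)
    (hyw : P.proj (Set.Ioo Ea Eb) y ∈ Submodule.span 𝕜 (Set.range fun j => (w j : ℋ))) (c : ℝ) :
    ∫ E in Set.Ioo Ea Eb, (E - c) ∂P.measure y =
      ∑ j, ‖inner 𝕜 (w j : ℋ) y‖ ^ 2 * (ν j - c) := by
  have h := hw.eq_sum_of_mem_span hyw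
  simp_rw [← P.inner_proj measurableSet_Ioo, hwP] at h
  rw [integral_Ioo_eq hP hy, h, hw.integral_id hP, hw.norm_sq_sum, Finset.mul_sum,
    ← Finset.sum_sub_distrib]
  exact Finset.sum_congr rfl fun j _ => by ring

variable (hP : IsSpectralResolution H P) (hE : Ea < Eb) (he : IsRitzFamily H e μ)
  (hev : ∀ i, (e i : ℋ) ∈ Submodule.span 𝕜 (Set.range fun l => (v l : ℋ)))
  (hw : IsRitzFamily H w ν) (hwP : ∀ j, P.proj (Set.Ioo Ea Eb) (w j : ℋ) = w j)
  (hvw : ∀ y ∈ Submodule.span 𝕜 (Set.range fun l => (v l : ℋ)),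
    P.proj (Set.Ioo Ea Eb) y ∈ Submodule.span 𝕜 (Set.range fun j => (w j : ℋ)))
  (hg : 0 ≤ g) (hu : IsCoercive 𝕜 (fun l => (v l : ℋ)) g)

include hP hE he hev hw hwP hvw hg hu

/-- The level `c` is left free: `c = ν i` is the usual choice, while an endpoint of the interval
serves when `w` has too few members. -/
theorem mul_ritz_sub_le (i : Fin n) {c : ℝ} (hc : c ∈ Set.Icc Ea Eb)
    (hci : ∀ j : Fin r, (i : ℕ) ≤ j → ν j ≤ c) :
    g * (μ i - c) ≤ ∫ E in Set.Ici Eb, (E - c) ∂specMeasure P fun l => (v l : ℋ) := by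
  classical
  obtain ⟨a, ha, hy0, hort⟩ := he.exists_orthogonal (fun j => (w j : ℋ)) (Finset.Iic i)
    -- Indices start at zero: `i + 1` coefficients against at most `i` conditions.
    (Finset.univ.filter fun j : Fin r => (j : ℕ) < i) (by
      rw [Fin.card_Iic]
      refine (Finset.card_le_card_of_injOn (t := Finset.range i) Fin.val ?_
        Fin.val_injective.injOn).trans_lt (by simp)
      intro j hj
      simpa using hj)
  have hint := he.integral_id hP a
  have hnorm := he.norm_sq_sum a
  have hyd : ∑ i, a i • (e i : ℋ) ∈ H.domain := by
    rw [← IsRitzFamily.coe_sum]; exact Subtype.property _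
  have hys : ∑ i, a i • (e i : ℋ) ∈ Submodule.span 𝕜 (Set.range fun l => (v l : ℋ)) :=
    Submodule.sum_mem _ fun i _ => Submodule.smul_mem _ _ (hev i)
  generalize ∑ i, a i • (e i : ℋ) = y at *
  have hlow : μ i * ‖y‖ ^ 2 ≤ ∫ E, E ∂P.measure y := by
    rw [hint, hnorm, Finset.mul_sum]
    refine Finset.sum_le_sum fun k _ => ?_
    by_cases hk : k ∈ Finset.Iic i
    · rw [mul_comm]
      exact mul_le_mul_of_nonneg_left (he.antitone (Finset.mem_Iic.1 hk)) (by positivity)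
    · simp [ha k hk]
  have hsplit := integral_eq_add_Iic_Ioo_Ici hE
    ((hP.integrable_id hyd).sub (integrable_const c))
  simp only [Pi.sub_apply] at hsplit
  rw [hP.integral_sub hyd] at hsplit
  have h1 : ∫ E in Set.Iic Ea, (E - c) ∂P.measure y ≤ 0 :=
    setIntegral_nonpos measurableSet_Iic fun E hE => sub_nonpos.2 (hE.trans hc.1)
  have h2 : ∫ E in Set.Ioo Ea Eb, (E - c) ∂P.measure y ≤ 0 := by
    rw [integral_Ioo_eq_sum hP hw hwP hyd (hvw y hys)]
    refine Finset.sum_nonpos fun j _ => ?_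
    by_cases hj : (j : ℕ) < i
    · simp [hort j (by simpa using hj)]
    · exact mul_nonpos_of_nonneg_of_nonpos (by positivity) (sub_nonpos.2 (hci j (not_lt.1 hj)))
  have h3 := mul_setIntegral_le (P := P) hg hu hys measurableSet_Ici
    (integrable_specMeasure hP v c) fun E (hE : Eb ≤ E) => sub_nonneg.2 (hc.2.trans hE)
  have hpos : 0 < ‖y‖ ^ 2 := by positivity
  have h4 : (μ i - c) * ‖y‖ ^ 2 ≤ ∫ E in Set.Ici Eb, (E - c) ∂P.measure y := by linarith
  refine le_of_mul_le_mul_left ?_ hpos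
  calc ‖y‖ ^ 2 * (g * (μ i - c)) = g * ((μ i - c) * ‖y‖ ^ 2) := by ring
    _ ≤ _ := (mul_le_mul_of_nonneg_left h4 hg).trans h3

/-- The test vector now comes from the lower Ritz vectors: `n - i` coefficients against at most `r -
i - 1` conditions, which is where `r ≤ n` enters. -/
theorem le_mul_ritz_sub (hrn : r ≤ n) (i : Fin n) {c : ℝ} (hc : c ∈ Set.Icc Ea Eb)
    (hci : ∀ j : Fin r, (j : ℕ) ≤ i → c ≤ ν j) :
    ∫ E in Set.Iic Ea, (E - c) ∂specMeasure P (fun l => (v l : ℋ)) ≤ g * (μ i - c) := by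
  classical
  obtain ⟨a, ha, hy0, hort⟩ := he.exists_orthogonal (fun j => (w j : ℋ)) (Finset.Ici i)
    (Finset.univ.filter fun j : Fin r => (i : ℕ) < j) (by
      rw [Fin.card_Ici]
      refine (Finset.card_le_card_of_injOn (t := Finset.Ioo (i : ℕ) r) Fin.val ?_
        Fin.val_injective.injOn).trans_lt ?_
      · intro j hj
        simpa using hj
      · rw [Nat.card_Ioo]
        omega)
  have hint := he.integral_id hP a
  have hnorm := he.norm_sq_sum a
  have hyd : ∑ i, a i • (e i : ℋ) ∈ H.domain := by
    rw [← IsRitzFamily.coe_sum]; exact Subtype.property _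
  have hys : ∑ i, a i • (e i : ℋ) ∈ Submodule.span 𝕜 (Set.range fun l => (v l : ℋ)) :=
    Submodule.sum_mem _ fun i _ => Submodule.smul_mem _ _ (hev i)
  generalize ∑ i, a i • (e i : ℋ) = y at *
  have hupp : ∫ E, E ∂P.measure y ≤ μ i * ‖y‖ ^ 2 := by
    rw [hint, hnorm, Finset.mul_sum]
    refine Finset.sum_le_sum fun k _ => ?_
    by_cases hk : k ∈ Finset.Ici i
    · rw [mul_comm]
      exact mul_le_mul_of_nonneg_right (he.antitone (Finset.mem_Ici.1 hk)) (by positivity)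
    · simp [ha k hk]
  have hsplit := integral_eq_add_Iic_Ioo_Ici hE
    ((hP.integrable_id hyd).sub (integrable_const c))
  simp only [Pi.sub_apply] at hsplit
  rw [hP.integral_sub hyd] at hsplit
  have h1 : 0 ≤ ∫ E in Set.Ici Eb, (E - c) ∂P.measure y :=
    setIntegral_nonneg measurableSet_Ici fun E (hE : Eb ≤ E) => sub_nonneg.2 (hc.2.trans hE)
  have h2 : 0 ≤ ∫ E in Set.Ioo Ea Eb, (E - c) ∂P.measure y := by
    rw [integral_Ioo_eq_sum hP hw hwP hyd (hvw y hys)]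
    refine Finset.sum_nonneg fun j _ => ?_
    by_cases hj : (i : ℕ) < j
    · simp [hort j (by simpa using hj)]
    · exact mul_nonneg (by positivity) (sub_nonneg.2 (hci j (not_lt.1 hj)))
  have h3 := mul_setIntegral_le (P := P) hg hu hys measurableSet_Iic
    (integrable_specMeasure hP v c).neg fun E (hE : E ≤ Ea) => by
      simpa using hE.trans hc.1
  simp only [Pi.neg_apply, MeasureTheory.integral_neg] at h3
  have hpos : 0 < ‖y‖ ^ 2 := by positivity
  have h4 : ∫ E in Set.Iic Ea, (E - c) ∂P.measure y ≤ (μ i - c) * ‖y‖ ^ 2 := by linarith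
  have h5 := mul_le_mul_of_nonneg_left h4 hg
  refine le_of_mul_le_mul_left ?_ hpos
  calc _ ≤ g * ((μ i - c) * ‖y‖ ^ 2) := by linarith
    _ = _ := by ring

end Comparison

end GEP

/-! ### Eigenvalues of Gram matrices. -/

namespace GEP

variable {𝕜 ℋ : Type*} [RCLike 𝕜] [NormedAddCommGroup ℋ] [InnerProductSpace 𝕜 ℋ]
  [CompleteSpace ℋ] {M : ℕ}

/-- An orthonormal eigenbasis of the Gram matrix, with eigenvalues in descending order. -/
def IsGramBasis (v : Fin M → ℋ) (b : OrthonormalBasis (Fin M) 𝕜 (EuclideanSpace 𝕜 (Fin M))) :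
    Prop :=
  ∀ k, gram 𝕜 v *ᵥ (b k).ofLp = ((gramEig 𝕜 v (k + 1) : ℝ) : 𝕜) • (b k).ofLp

theorem gramEig_succ (v : Fin M → ℋ) (k : Fin M) :
    gramEig 𝕜 v (k + 1) =
      (isHermitian_gram 𝕜 v).eigenvalues₀ (finCongr (Fintype.card_fin M).symm k) := by
  unfold gramEig
  rw [dif_pos ⟨by omega, k.2⟩]
  rfl

theorem gramEig_of_le (v : Fin M → ℋ) {k : ℕ} (h1 : 1 ≤ k) (h2 : k ≤ M) :
    ∃ j : Fin M, (j : ℕ) + 1 = k ∧ gramEig 𝕜 v k = gramEig 𝕜 v (j + 1) :=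
  ⟨⟨k - 1, by omega⟩, by simp; omega, by simp only; congr 1; omega⟩

/-- `eigenvalues₀` is sorted, whereas eigenvectors and trace formula refer to `eigenvalues`, whose
indexing need not be; `σ` translates between them. -/
theorem exists_equiv_eigenvalues (v : Fin M → ℋ) :
    ∃ σ : Fin M ≃ Fin M, ∀ k : Fin M,
      gramEig 𝕜 v (k + 1) = (isHermitian_gram 𝕜 v).eigenvalues (σ k) := by
  refine ⟨(finCongr (Fintype.card_fin M).symm).trans
    (Fintype.equivOfCardEq (Fintype.card_fin _)), fun k => ?_⟩
  rw [gramEig_succ]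
  simp [IsHermitian.eigenvalues]

theorem exists_isGramBasis (v : Fin M → ℋ) :
    ∃ b : OrthonormalBasis (Fin M) 𝕜 (EuclideanSpace 𝕜 (Fin M)), IsGramBasis v b := by
  obtain ⟨σ, hσ⟩ := exists_equiv_eigenvalues (𝕜 := 𝕜) v
  refine ⟨(isHermitian_gram 𝕜 v).eigenvectorBasis.reindex σ.symm, fun k => ?_⟩
  rw [hσ k, OrthonormalBasis.reindex_apply, Equiv.symm_symm,
    IsHermitian.mulVec_eigenvectorBasis]
  ext i
  simp [RCLike.real_smul_eq_coe_mul]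

theorem gramEig_antitone (v : Fin M → ℋ) : Antitone fun k : Fin M => gramEig 𝕜 v (k + 1) := by
  intro j k hjk
  simp only [gramEig_succ]
  exact (isHermitian_gram 𝕜 v).eigenvalues₀_antitone hjk

theorem gramEig_nonneg (v : Fin M → ℋ) (k : ℕ) : 0 ≤ gramEig 𝕜 v k := by
  by_cases h : 1 ≤ k ∧ k ≤ M
  · obtain ⟨j, -, hj⟩ := gramEig_of_le (𝕜 := 𝕜) v h.1 h.2
    obtain ⟨σ, hσ⟩ := exists_equiv_eigenvalues (𝕜 := 𝕜) v
    rw [hj, hσ]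
    exact (posSemidef_gram 𝕜 v).eigenvalues_nonneg _
  · rw [gramEig, dif_neg h]

theorem gramRank_eq_card (v : Fin M → ℋ) :
    gramRank 𝕜 v = (Finset.univ.filter fun k : Fin M => gramEig 𝕜 v (k + 1) ≠ 0).card := by
  obtain ⟨σ, hσ⟩ := exists_equiv_eigenvalues (𝕜 := 𝕜) v
  rw [gramRank, (isHermitian_gram 𝕜 v).rank_eq_card_non_zero_eigs, Fintype.card_subtype]
  simp only [hσ]
  symm
  refine Finset.card_equiv σ fun k => ?_
  simp

/-- The initial segment on which a descending sequence satisfies an upward closed condition. -/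
theorem lt_card_filter_iff {f : Fin M → ℝ} (hf : Antitone f) {p : ℝ → Prop} [DecidablePred p]
    (hp : ∀ s t, s ≤ t → p s → p t) (k : Fin M) :
    (k : ℕ) < (Finset.univ.filter fun j => p (f j)).card ↔ p (f k) := by
  constructor
  · intro h
    by_contra hk
    have : (Finset.univ.filter fun j => p (f j)) ⊆ Finset.Iio k := by
      intro j hj
      rw [Finset.mem_filter] at hj
      rw [Finset.mem_Iio]
      by_contra hjk
      exact hk (hp _ _ (hf (not_lt.1 hjk)) hj.2)
    have := Finset.card_le_card this
    rw [Fin.card_Iio] at this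
    omega
  · intro h
    have : Finset.Iic k ⊆ Finset.univ.filter fun j => p (f j) := by
      intro j hj
      rw [Finset.mem_filter]
      exact ⟨Finset.mem_univ _, hp _ _ (hf (Finset.mem_Iic.1 hj)) h⟩
    have := Finset.card_le_card this
    rw [Fin.card_Iic] at this
    omega

/-- Being nonzero is the same as being positive here, an upward closed condition, so the nonzero
eigenvalues form an initial segment. -/
theorem lt_gramRank_iff (v : Fin M → ℋ) (k : Fin M) :
    (k : ℕ) < gramRank 𝕜 v ↔ gramEig 𝕜 v (k + 1) ≠ 0 := by
  classical
  have h : (Finset.univ.filter fun k : Fin M => gramEig 𝕜 v (k + 1) ≠ 0) =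
      Finset.univ.filter fun k : Fin M => 0 < gramEig 𝕜 v (k + 1) :=
    Finset.filter_congr fun k _ => ((gramEig_nonneg v _).lt_iff_ne').symm
  rw [gramRank_eq_card, h, lt_card_filter_iff (gramEig_antitone v) (p := fun t => 0 < t)
    (fun s t hst hs => hs.trans_le hst), (gramEig_nonneg v _).lt_iff_ne']

theorem lt_detectedDim_iff (v : Fin M → ℋ) (ε : ℝ) (k : Fin M) :
    (k : ℕ) < detectedDim 𝕜 v ε ↔ ε ≤ gramEig 𝕜 v (k + 1) :=
  lt_card_filter_iff (gramEig_antitone v) (p := fun t => ε ≤ t) (fun _ _ hst hs => hs.trans hst) k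

theorem gramRank_le (v : Fin M → ℋ) : gramRank 𝕜 v ≤ M :=
  ((gram 𝕜 v).rank_le_card_width).trans_eq (Fintype.card_fin M)

theorem gramEig_gramRank_pos (v : Fin M → ℋ) (h : 1 ≤ gramRank 𝕜 v) :
    0 < gramEig 𝕜 v (gramRank 𝕜 v) := by
  obtain ⟨j, hj, hj'⟩ := gramEig_of_le (𝕜 := 𝕜) v h (gramRank_le v)
  rw [hj']
  exact (gramEig_nonneg v _).lt_of_ne' ((lt_gramRank_iff v j).1 (by omega))

theorem gramEig_gramRank_le (v : Fin M → ℋ) {k : Fin M} (h : gramEig 𝕜 v (k + 1) ≠ 0) :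
    gramEig 𝕜 v (gramRank 𝕜 v) ≤ gramEig 𝕜 v (k + 1) := by
  have hk := (lt_gramRank_iff v k).2 h
  obtain ⟨j, hj, hj'⟩ := gramEig_of_le (𝕜 := 𝕜) v (by omega) (gramRank_le (𝕜 := 𝕜) v)
  rw [hj']
  exact gramEig_antitone v (Fin.le_def.2 (by omega))

theorem sum_norm_sq_eq (v : Fin M → ℋ) : ∑ l, ‖v l‖ ^ 2 = ∑ k : Fin M, gramEig 𝕜 v (k + 1) := by
  obtain ⟨σ, hσ⟩ := exists_equiv_eigenvalues (𝕜 := 𝕜) v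
  have h := (isHermitian_gram 𝕜 v).trace_eq_sum_eigenvalues
  simp only [hσ]
  rw [Equiv.sum_comp σ (isHermitian_gram 𝕜 v).eigenvalues]
  apply RCLike.ofReal_injective (K := 𝕜)
  rw [RCLike.ofReal_sum (K := 𝕜) Finset.univ (isHermitian_gram 𝕜 v).eigenvalues, ← h]
  simp [Matrix.trace, gram_apply, inner_self_eq_norm_sq_to_K]

section

variable {v : Fin M → ℋ} {b : OrthonormalBasis (Fin M) 𝕜 (EuclideanSpace 𝕜 (Fin M))}

theorem IsGramBasis.inner_sum (hb : IsGramBasis v b) (k : Fin M)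
    (x : EuclideanSpace 𝕜 (Fin M)) :
    inner 𝕜 (∑ l, b k l • v l) (∑ l, x l • v l) = (gramEig 𝕜 v (k + 1) : 𝕜) * inner 𝕜 (b k) x := by
  rw [← inner_conj_symm, ← star_dotProduct_gram, hb k, dotProduct_smul, smul_eq_mul, map_mul,
    RCLike.conj_ofReal, ← inner_conj_symm (b k) x, EuclideanSpace.inner_eq_star_dotProduct x,
    dotProduct_comm]

theorem IsGramBasis.sum_eq (v : Fin M → ℋ)
    (b : OrthonormalBasis (Fin M) 𝕜 (EuclideanSpace 𝕜 (Fin M))) (x : EuclideanSpace 𝕜 (Fin M)) :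
    ∑ l, x l • v l = ∑ k, (inner 𝕜 (b k) x) • ∑ l, b k l • v l := by
  simp only [Finset.smul_sum]
  rw [Finset.sum_comm]
  refine Finset.sum_congr rfl fun l _ => ?_
  have : x l = ∑ k, inner 𝕜 (b k) x * b k l := by
    conv_lhs => rw [← b.sum_repr' x]
    simp
  rw [this, Finset.sum_smul]
  simp only [mul_smul]

theorem IsGramBasis.norm_sq_sum (hb : IsGramBasis v b) (x : EuclideanSpace 𝕜 (Fin M)) :
    ‖∑ l, x l • v l‖ ^ 2 = ∑ k : Fin M, gramEig 𝕜 v (k + 1) * ‖inner 𝕜 (b k) x‖ ^ 2 := by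
  rw [← inner_self_eq_norm_sq (𝕜 := 𝕜)]
  nth_rw 1 [IsGramBasis.sum_eq v b x]
  rw [_root_.sum_inner, map_sum]
  refine Finset.sum_congr rfl fun k _ => ?_
  rw [inner_smul_left, hb.inner_sum, mul_left_comm, RCLike.conj_mul, ← RCLike.ofReal_pow,
    ← RCLike.ofReal_mul, RCLike.ofReal_re]

theorem IsGramBasis.norm_sq_basis (hb : IsGramBasis v b) (k : Fin M) :
    ‖∑ l, b k l • v l‖ ^ 2 = gramEig 𝕜 v (k + 1) := by
  rw [← inner_self_eq_norm_sq (𝕜 := 𝕜), hb.inner_sum, inner_self_eq_norm_sq_to_K,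
    b.orthonormal.1 k]
  simp

end

theorem norm_sq_sum_le (v : Fin M → ℋ) (x : Fin M → 𝕜) :
    ‖∑ l, x l • v l‖ ^ 2 ≤ gramEig 𝕜 v 1 * ∑ l, ‖x l‖ ^ 2 := by
  obtain ⟨b, hb⟩ := exists_isGramBasis (𝕜 := 𝕜) v
  have h := hb.norm_sq_sum (WithLp.toLp 2 x)
  simp only at h
  rw [h]
  have hx : ∑ l, ‖x l‖ ^ 2 = ∑ k, ‖inner 𝕜 (b k) (WithLp.toLp 2 x)‖ ^ 2 := by
    rw [b.sum_sq_norm_inner_right, EuclideanSpace.norm_sq_eq]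
  rw [hx, Finset.mul_sum]
  refine Finset.sum_le_sum fun k _ => mul_le_mul_of_nonneg_right ?_ (by positivity)
  have := gramEig_antitone (𝕜 := 𝕜) v
    (show (⟨0, by have := k.2; omega⟩ : Fin M) ≤ k from Fin.le_def.2 (Nat.zero_le _))
  simpa using this

theorem gramEig_one_le (v : Fin M → ℋ) {C : ℝ} (hC : 0 ≤ C)
    (h : ∀ x : Fin M → 𝕜, ‖∑ l, x l • v l‖ ^ 2 ≤ C * ∑ l, ‖x l‖ ^ 2) : gramEig 𝕜 v 1 ≤ C := by
  rcases Nat.eq_zero_or_pos M with hM | hM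
  · rw [gramEig, dif_neg (by omega)]
    exact hC
  · obtain ⟨b, hb⟩ := exists_isGramBasis (𝕜 := 𝕜) v
    have h1 := hb.norm_sq_basis ⟨0, hM⟩
    have h2 := h (b ⟨0, hM⟩)
    rw [h1, ← EuclideanSpace.norm_sq_eq, b.orthonormal.1] at h2
    simpa using h2

theorem gramEig_one_le_sum (v : Fin M → ℋ) : gramEig 𝕜 v 1 ≤ ∑ l, ‖v l‖ ^ 2 :=
  gramEig_one_le v (by positivity) fun x => (norm_sum_smul_sq_le x v).trans_eq (mul_comm _ _)

/-- The trace is a sum of `gramRank` nonzero eigenvalues, each at most the first. -/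
theorem sum_norm_sq_le (v : Fin M → ℋ) :
    ∑ l, ‖v l‖ ^ 2 ≤ gramRank 𝕜 v * gramEig 𝕜 v 1 := by
  rw [sum_norm_sq_eq (𝕜 := 𝕜), gramRank_eq_card, ← nsmul_eq_mul, ← Finset.sum_filter_ne_zero]
  refine Finset.sum_le_card_nsmul _ _ _ fun k _ => ?_
  have := gramEig_antitone (𝕜 := 𝕜) v
    (show (⟨0, by have := k.2; omega⟩ : Fin M) ≤ k from Fin.le_def.2 (Nat.zero_le _))
  simpa using this

/-- The smallest non-zero eigenvalue of the Gram matrix is a coercivity constant. -/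
theorem isCoercive_gramEig (v : Fin M → ℋ) :
    IsCoercive 𝕜 v (gramEig 𝕜 v (gramRank 𝕜 v)) := by
  classical
  intro y hy
  rw [← Fintype.range_linearCombination] at hy
  obtain ⟨x, rfl⟩ := hy
  rw [Fintype.linearCombination_apply]
  obtain ⟨b, hb⟩ := exists_isGramBasis (𝕜 := 𝕜) v
  -- Coordinates are not unique when the guess vectors are dependent; `z` drops the kernel component
  -- of `x`.
  let z : EuclideanSpace 𝕜 (Fin M) := ∑ k : Fin M,
    (if gramEig 𝕜 v (k + 1) ≠ 0 then inner 𝕜 (b k) (WithLp.toLp 2 x) else 0) • b k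
  have hz : ∀ k : Fin M, inner 𝕜 (b k) z =
      if gramEig 𝕜 v (k + 1) ≠ 0 then inner 𝕜 (b k) (WithLp.toLp 2 x) else 0 := fun k =>
    b.orthonormal.inner_right_fintype _ k
  have hxz : ∑ l, x l • v l = ∑ l, z l • v l := by
    have h1 := IsGramBasis.sum_eq v b (WithLp.toLp 2 x)
    simp only at h1
    rw [h1, IsGramBasis.sum_eq v b z]
    refine Finset.sum_congr rfl fun k _ => ?_
    rw [hz]
    split_ifs with h
    · rfl
    · have h2 := hb.norm_sq_basis k
      rw [not_not.1 h] at h2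
      rw [pow_eq_zero_iff two_ne_zero, norm_eq_zero] at h2
      rw [h2, smul_zero, smul_zero]
  refine ⟨z, hxz, ?_⟩
  rw [hxz, hb.norm_sq_sum, ← EuclideanSpace.norm_sq_eq, ← b.sum_sq_norm_inner_right,
    Finset.mul_sum]
  refine Finset.sum_le_sum fun k _ => ?_
  by_cases h : gramEig 𝕜 v (k + 1) = 0
  · rw [hz, if_neg (not_not.2 h)]
    simp
  · exact mul_le_mul_of_nonneg_right (gramEig_gramRank_le v h) (by positivity)

theorem one_le_gramRank (v : Fin M → ℋ) {x : Fin M → 𝕜} (hx : ∑ l, x l • v l ≠ 0) :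
    1 ≤ gramRank 𝕜 v := by
  rw [gramRank_eq, Nat.one_le_iff_ne_zero]
  intro h
  have : FiniteDimensional 𝕜 (Submodule.span 𝕜 (Set.range v)) :=
    FiniteDimensional.span_of_finite 𝕜 (Set.finite_range v)
  rw [Submodule.finrank_eq_zero] at h
  apply hx
  rw [← Submodule.mem_bot (R := 𝕜), ← h]
  exact Submodule.sum_mem _ fun l _ => Submodule.smul_mem _ _ (Submodule.subset_span ⟨l, rfl⟩)

/-- A perturbation bound for the smallest non-zero eigenvalue of the Gram matrix. -/
theorem sub_le_lowestGramEig (v w : Fin M → ℋ) (hv : 1 ≤ gramRank 𝕜 v)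
    (hker : ∀ x : Fin M → 𝕜, ∑ l, x l • v l = 0 → ∑ l, x l • w l = 0) {κ : ℝ}
    (hκ : ∀ x : Fin M → 𝕜, ‖∑ l, x l • v l‖ ^ 2 ≤ ‖∑ l, x l • w l‖ ^ 2 + κ * ∑ l, ‖x l‖ ^ 2)
    (hpos : 0 < gramEig 𝕜 v (gramRank 𝕜 v) - κ) :
    gramEig 𝕜 v (gramRank 𝕜 v) - κ ≤ lowestGramEig 𝕜 w := by
  obtain ⟨b, hb⟩ := exists_isGramBasis (𝕜 := 𝕜) v
  obtain ⟨b', hb'⟩ := exists_isGramBasis (𝕜 := 𝕜) w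
  have hone : ∀ (c : OrthonormalBasis (Fin M) 𝕜 (EuclideanSpace 𝕜 (Fin M))) (k : Fin M),
      ∑ l, ‖c k l‖ ^ 2 = 1 := by
    intro c k
    rw [← EuclideanSpace.norm_sq_eq, c.orthonormal.1, one_pow]
  -- Were `w` to vanish on the eigenvector `b j` of the smallest nonzero eigenvalue, `hκ` would
  -- bound that eigenvalue by `κ`.
  have hw : 1 ≤ gramRank 𝕜 w := by
    obtain ⟨j, -, hj⟩ := gramEig_of_le (𝕜 := 𝕜) v hv (gramRank_le v)
    refine one_le_gramRank w (x := b j) fun h0 => ?_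
    have := hκ (b j)
    rw [h0, hb.norm_sq_basis, hone, ← hj, norm_zero] at this
    linarith
  obtain ⟨j, hj1, hj⟩ := gramEig_of_le (𝕜 := 𝕜) w hw (gramRank_le w)
  have hne : gramEig 𝕜 w (j + 1) ≠ 0 := (lt_gramRank_iff w j).1 (by omega)
  -- An eigenvector of the Gram matrix of `w` with nonzero eigenvalue is orthogonal to its kernel,
  -- which contains that of `v` by `hker`.
  have horth : ∀ k : Fin M, gramEig 𝕜 v (k + 1) = 0 → inner 𝕜 (b k) (b' j) = 0 := by
    intro k hk
    have h1 := hb.norm_sq_basis k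
    rw [hk, pow_eq_zero_iff two_ne_zero, norm_eq_zero] at h1
    have h2 := hb'.inner_sum j (b k)
    rw [hker _ h1, inner_zero_right] at h2
    have h3 : inner 𝕜 (b' j) (b k) = 0 := by
      rcases mul_eq_zero.1 h2.symm with h | h
      · exact absurd (RCLike.ofReal_eq_zero.1 h) hne
      · exact h
    exact inner_eq_zero_symm.1 h3
  have hlow : gramEig 𝕜 v (gramRank 𝕜 v) ≤ ‖∑ l, b' j l • v l‖ ^ 2 := by
    have h4 := b.sum_sq_norm_inner_right (b' j)
    rw [b'.orthonormal.1, one_pow] at h4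
    rw [hb.norm_sq_sum, ← mul_one (gramEig 𝕜 v (gramRank 𝕜 v)), ← h4, Finset.mul_sum]
    refine Finset.sum_le_sum fun k _ => ?_
    by_cases h : gramEig 𝕜 v (k + 1) = 0
    · simp [horth k h]
    · exact mul_le_mul_of_nonneg_right (gramEig_gramRank_le v h) (by positivity)
  have h5 := hκ (b' j)
  rw [hb'.norm_sq_basis, hone, ← hj] at h5
  unfold lowestGramEig
  linarith

end GEP

/-! ### Ritz families of the GEP and spectral projections of guess vectors. -/

namespace GEP

variable {𝕜 ℋ : Type*} [RCLike 𝕜] [NormedAddCommGroup ℋ] [InnerProductSpace 𝕜 ℋ]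
  [CompleteSpace ℋ] {M : ℕ} {H : ℋ →ₗ.[𝕜] ℋ} {P : ProjValuedMeasure 𝕜 ℋ} {Ea Eb : ℝ}

theorem star_dotProduct_projMatrix (v : Fin M → H.domain) (x y : Fin M → 𝕜) :
    star x ⬝ᵥ (projMatrix H v *ᵥ y) =
      inner 𝕜 ((∑ l, x l • v l : H.domain) : ℋ) (H (∑ l, y l • v l)) := by
  have hH : H (∑ l, y l • v l) = ∑ l, y l • H (v l) := by
    change H.toFun _ = _
    rw [map_sum]
    simp only [map_smul]
    rfl
  rw [hH, IsRitzFamily.coe_sum, sum_inner]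
  refine Finset.sum_congr rfl fun i _ => ?_
  rw [inner_smul_left, inner_sum]
  simp [mulVec, dotProduct, inner_smul_right, projMatrix, mul_comm]

/-- The proper eigenvectors of the GEP form a Ritz family that spans the guess space. -/
theorem exists_isRitzFamily (hH : IsSelfAdjoint H) (v : Fin M → H.domain) :
    ∃ (μ : Fin (gramRank 𝕜 fun l => (v l : ℋ)) → ℝ)
      (e : Fin (gramRank 𝕜 fun l => (v l : ℋ)) → H.domain),
      IsRitzFamily H e μ ∧
      (∀ i : Fin (gramRank 𝕜 fun l => (v l : ℋ)), genEig hH v (i + 1) = μ i) ∧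
      Submodule.span 𝕜 (Set.range fun i => (e i : ℋ)) =
        Submodule.span 𝕜 (Set.range fun l => (v l : ℋ)) := by
  obtain ⟨hanti, x, hx, hort⟩ := (exists_isProperSpectrum hH v).choose_spec
  have hdelta : ∀ i j, inner 𝕜 ((∑ l, x i l • v l : H.domain) : ℋ)
      ((∑ l, x j l • v l : H.domain) : ℋ) = if i = j then 1 else 0 := by
    intro i j
    rw [← hort i j, gramMatrix, star_dotProduct_gram, IsRitzFamily.coe_sum, IsRitzFamily.coe_sum]
  have hR : IsRitzFamily H (fun i => ∑ l, x i l • v l) (exists_isProperSpectrum hH v).choose := by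
    refine ⟨orthonormal_iff_ite.2 hdelta, fun i j => ?_, hanti⟩
    rw [← star_dotProduct_projMatrix, hx j, dotProduct_smul, hort i j]
    split_ifs <;> simp
  refine ⟨_, _, hR, fun i => ?_, ?_⟩
  · rw [genEig, dif_pos ⟨by omega, i.2⟩]
    rfl
  · have : FiniteDimensional 𝕜 (Submodule.span 𝕜 (Set.range fun l => (v l : ℋ))) :=
      FiniteDimensional.span_of_finite 𝕜 (Set.finite_range _)
    refine Submodule.eq_of_le_of_finrank_eq ?_ ?_
    · rw [Submodule.span_le]
      rintro _ ⟨i, rfl⟩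
      simp only [IsRitzFamily.coe_sum]
      exact Submodule.sum_mem _ fun l _ =>
        Submodule.smul_mem _ _ (Submodule.subset_span ⟨l, rfl⟩)
    · rw [finrank_span_eq_card hR.orthonormal.linearIndependent, Fintype.card_fin, gramRank_eq]

theorem proj_mem_span (S : Set ℝ) (u : Fin M → ℋ) {y : ℋ}
    (hy : y ∈ Submodule.span 𝕜 (Set.range u)) :
    P.proj S y ∈ Submodule.span 𝕜 (Set.range (restrictTo P S u)) := by
  have h := Submodule.mem_map_of_mem (f := (P.proj S : ℋ →ₗ[𝕜] ℋ)) hy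
  rw [Submodule.map_span, ← Set.range_comp] at h
  exact h

theorem gramRank_restrictTo_le (S : Set ℝ) (u : Fin M → ℋ) :
    gramRank 𝕜 (restrictTo P S u) ≤ gramRank 𝕜 u := by
  have : FiniteDimensional 𝕜 (Submodule.span 𝕜 (Set.range u)) :=
    FiniteDimensional.span_of_finite 𝕜 (Set.finite_range _)
  have h := Submodule.finrank_map_le (P.proj S : ℋ →ₗ[𝕜] ℋ) (Submodule.span 𝕜 (Set.range u))
  rw [Submodule.map_span, ← Set.range_comp] at h
  rw [gramRank_eq, gramRank_eq]
  exact h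

theorem proj_eq_self_of_mem_span {S : Set ℝ} (hS : MeasurableSet S) (u : Fin M → ℋ) {y : ℋ}
    (hy : y ∈ Submodule.span 𝕜 (Set.range (restrictTo P S u))) : P.proj S y = y := by
  induction hy using Submodule.span_induction with
  | mem y hy =>
    obtain ⟨l, rfl⟩ := hy
    exact P.proj_idem hS _
  | zero => simp
  | add y z _ _ hy hz => rw [map_add, hy, hz]
  | smul a y _ hy => rw [map_smul, hy]

theorem proj_sum (S : Set ℝ) (u : Fin M → ℋ) (x : Fin M → 𝕜) :
    ∑ l, x l • restrictTo P S u l = P.proj S (∑ l, x l • u l) := by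
  simp [restrictTo]

theorem noise_eq (u : Fin M → ℋ) : noise P Ea Eb u = restrictTo P (Set.Ioo Ea Eb)ᶜ u :=
  funext fun l => P.sub_proj measurableSet_Ioo (u l)

theorem compl_Ioo_eq : (Set.Ioo Ea Eb)ᶜ = Set.Iic Ea ∪ Set.Ici Eb := by
  ext t
  simp only [Set.mem_compl_iff, Set.mem_Ioo, not_and_or, not_lt, Set.mem_union, Set.mem_Iic,
    Set.mem_Ici]

theorem norm_sq_compl_Ioo (P : ProjValuedMeasure 𝕜 ℋ) (hE : Ea < Eb) (y : ℋ) :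
    ‖P.proj (Set.Ioo Ea Eb)ᶜ y‖ ^ 2 =
      ‖P.proj (Set.Iic Ea) y‖ ^ 2 + ‖P.proj (Set.Ici Eb) y‖ ^ 2 := by
  rw [← P.real_apply y measurableSet_Ioo.compl, ← P.real_apply y measurableSet_Iic,
    ← P.real_apply y measurableSet_Ici, compl_Ioo_eq]
  exact measureReal_union (Set.disjoint_left.2 fun t (h : t ≤ Ea) (h' : Eb ≤ t) => by linarith)
    measurableSet_Ici

theorem gramEig_one_restrictTo_mono {S T : Set ℝ} (hS : MeasurableSet S) (hT : MeasurableSet T)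
    (hST : S ⊆ T) (u : Fin M → ℋ) :
    gramEig 𝕜 (restrictTo P S u) 1 ≤ gramEig 𝕜 (restrictTo P T u) 1 := by
  refine gramEig_one_le _ (gramEig_nonneg _ _) fun x => ?_
  refine le_trans ?_ (norm_sq_sum_le _ x)
  rw [proj_sum, proj_sum]
  exact P.norm_sq_mono hS hT hST _

theorem specMeasure_real_eq_sum {S : Set ℝ} (hS : MeasurableSet S) (u : Fin M → ℋ) :
    (specMeasure P u).real S = ∑ l, ‖restrictTo P S u l‖ ^ 2 :=
  specMeasure_real_apply u hS

/-! ### Certifiability and the bounds for certifiable signals. -/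

section Gap

variable {S : Set ℝ} (hS : MeasurableSet S) {u : Fin M → ℋ} (hm : 1 ≤ gramRank 𝕜 u)
include hS hm

/-- A negative gap would make the tail eigenvalue exceed a positive number, hence the tail trace
positive and the quotient negative. -/
theorem gap_pos_of_quotient_mem
    (hne : gramEig 𝕜 u (gramRank 𝕜 u) - gramEig 𝕜 (restrictTo P S u) 1 ≠ 0)
    (hmem : (specMeasure P u).real S /
      (gramEig 𝕜 u (gramRank 𝕜 u) - gramEig 𝕜 (restrictTo P S u) 1) ∈ Set.Icc (0 : ℝ) 1) :
    0 < gramEig 𝕜 u (gramRank 𝕜 u) - gramEig 𝕜 (restrictTo P S u) 1 ∧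
      (specMeasure P u).real S ≤
        gramEig 𝕜 u (gramRank 𝕜 u) - gramEig 𝕜 (restrictTo P S u) 1 := by
  have hT0 : 0 ≤ (specMeasure P u).real S := measureReal_nonneg
  have h1 : gramEig 𝕜 (restrictTo P S u) 1 ≤ (specMeasure P u).real S := by
    rw [specMeasure_real_eq_sum hS]
    exact gramEig_one_le_sum _
  have hpos : 0 < gramEig 𝕜 u (gramRank 𝕜 u) - gramEig 𝕜 (restrictTo P S u) 1 := by
    by_contra hneg
    have hlt := lt_of_le_of_ne (not_lt.1 hneg) hne
    have hm0 := gramEig_gramRank_pos u hm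
    have hTpos : 0 < (specMeasure P u).real S := by linarith
    exact absurd hmem.1 (not_le.2 (div_neg_of_pos_of_neg hTpos hlt))
  exact ⟨hpos, (div_le_one hpos).1 hmem.2⟩

/-- The tail eigenvalue `t` is at most that of the noise, so the gap is at least `(m + 1) t - t = m
t`, which dominates the tail trace. -/
theorem gap_pos_of_noise_le (hSc : S ⊆ (Set.Ioo Ea Eb)ᶜ)
    (h : ((gramRank 𝕜 u : ℝ) + 1) * gramEig 𝕜 (noise P Ea Eb u) 1 ≤
      gramEig 𝕜 u (gramRank 𝕜 u)) :
    0 < gramEig 𝕜 u (gramRank 𝕜 u) - gramEig 𝕜 (restrictTo P S u) 1 ∧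
      (specMeasure P u).real S ≤
        gramEig 𝕜 u (gramRank 𝕜 u) - gramEig 𝕜 (restrictTo P S u) 1 := by
  have hm0 := gramEig_gramRank_pos u hm
  have hS0 : 0 ≤ gramEig 𝕜 (restrictTo P S u) 1 := gramEig_nonneg _ _
  have hSN : gramEig 𝕜 (restrictTo P S u) 1 ≤ gramEig 𝕜 (noise P Ea Eb u) 1 := by
    rw [noise_eq]
    exact gramEig_one_restrictTo_mono hS measurableSet_Ioo.compl hSc u
  have hm1 : (1 : ℝ) ≤ gramRank 𝕜 u := by exact_mod_cast hm
  have hT : (specMeasure P u).real S ≤ gramRank 𝕜 u * gramEig 𝕜 (restrictTo P S u) 1 := by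
    rw [specMeasure_real_eq_sum hS]
    refine (sum_norm_sq_le _).trans (mul_le_mul_of_nonneg_right ?_ hS0)
    exact_mod_cast gramRank_restrictTo_le S u
  have h2 : ((gramRank 𝕜 u : ℝ) + 1) * gramEig 𝕜 (restrictTo P S u) 1 ≤
      gramEig 𝕜 u (gramRank 𝕜 u) :=
    (mul_le_mul_of_nonneg_left hSN (by positivity)).trans h
  refine ⟨?_, by linarith⟩
  rcases hS0.eq_or_lt with h0 | h0
  · rw [← h0]
    linarith
  · nlinarith

/-- The integrand is at most the inverse gap and the measure of `S` is at most the gap. `R E` stands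
for the half-line left after cutting the tail at `E`. -/
theorem lintegral_inv_lowestGramEig_le_one
    (hpos : 0 < gramEig 𝕜 u (gramRank 𝕜 u) - gramEig 𝕜 (restrictTo P S u) 1)
    (hT : (specMeasure P u).real S ≤
        gramEig 𝕜 u (gramRank 𝕜 u) - gramEig 𝕜 (restrictTo P S u) 1)
    {R : ℝ → Set ℝ} (hR : ∀ E, MeasurableSet (R E)) (hRS : ∀ E ∈ S, (R E)ᶜ ⊆ S) :
    ∫⁻ E in S, (ENNReal.ofReal (lowestGramEig 𝕜 (restrictTo P (R E) u)))⁻¹ ∂specMeasure P u ≤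
      1 := by
  set g := gramEig 𝕜 u (gramRank 𝕜 u) - gramEig 𝕜 (restrictTo P S u) 1 with hgdef
  have hle : ∀ E ∈ S, g ≤ lowestGramEig 𝕜 (restrictTo P (R E) u) := by
    intro E hE
    refine sub_le_lowestGramEig u _ hm (fun x hx => ?_) (fun x => ?_) hpos
    · rw [proj_sum, hx, map_zero]
    · rw [proj_sum, ← P.norm_sq_compl (hR E) (∑ l, x l • u l)]
      refine add_le_add le_rfl (le_trans ?_ (norm_sq_sum_le _ x))
      rw [proj_sum]
      exact P.norm_sq_mono (hR E).compl hS (hRS E hE) _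
  calc ∫⁻ E in S, (ENNReal.ofReal (lowestGramEig 𝕜 (restrictTo P (R E) u)))⁻¹ ∂specMeasure P u
      ≤ ∫⁻ _ in S, (ENNReal.ofReal g)⁻¹ ∂specMeasure P u :=
        setLIntegral_mono' hS fun E hE =>
          ENNReal.inv_le_inv.2 (ENNReal.ofReal_le_ofReal (hle E hE))
    _ = (ENNReal.ofReal g)⁻¹ * specMeasure P u S := setLIntegral_const _ _
    _ ≤ (ENNReal.ofReal g)⁻¹ * ENNReal.ofReal g := by
        gcongr
        rw [← ENNReal.ofReal_toReal (measure_ne_top (specMeasure P u) S)]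
        exact ENNReal.ofReal_le_ofReal hT
    _ ≤ 1 := ENNReal.inv_mul_le_one _

end Gap

theorem isCertifiable_of_noise_le (P : ProjValuedMeasure 𝕜 ℋ) {u : Fin M → ℋ}
    (hm : 1 ≤ gramRank 𝕜 u)
    (h : ((gramRank 𝕜 u : ℝ) + 1) * gramEig 𝕜 (noise P Ea Eb u) 1 ≤
      gramEig 𝕜 u (gramRank 𝕜 u)) : IsCertifiable P Ea Eb u := by
  have hup : Set.Ici Eb ⊆ (Set.Ioo Ea Eb)ᶜ := by
    rw [compl_Ioo_eq]; exact Set.subset_union_right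
  have hlo : Set.Iic Ea ⊆ (Set.Ioo Ea Eb)ᶜ := by
    rw [compl_Ioo_eq]; exact Set.subset_union_left
  obtain ⟨u1, u2⟩ := gap_pos_of_noise_le measurableSet_Ici hm hup h
  obtain ⟨l1, l2⟩ := gap_pos_of_noise_le measurableSet_Iic hm hlo h
  refine ⟨⟨?_, ?_⟩, u1.ne', ⟨div_nonneg measureReal_nonneg u1.le, (div_le_one u1).2 u2⟩,
    l1.ne', ⟨div_nonneg measureReal_nonneg l1.le, (div_le_one l1).2 l2⟩⟩
  · refine lintegral_inv_lowestGramEig_le_one measurableSet_Ici hm u1 u2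
      (fun E => measurableSet_Iio) fun E hE => ?_
    rw [Set.compl_Iio]
    exact Set.Ici_subset_Ici.2 hE
  · refine lintegral_inv_lowestGramEig_le_one measurableSet_Iic hm l1 l2
      (fun E => measurableSet_Ioi) fun E hE => ?_
    rw [Set.compl_Ioi]
    exact Set.Iic_subset_Iic.2 hE

/-- If the signal part annihilates a non-zero guess vector, both certifiability quotients
are equal to one. -/
theorem gap_eq_of_proj_eq_zero (hE : Ea < Eb) {u : Fin M → ℋ}
    (hup : (specMeasure P u).real (Set.Ici Eb) ≤ upperGap P Eb u)
    (hlo : (specMeasure P u).real (Set.Iic Ea) ≤ lowerGap P Ea u) {y : ℋ} (hy0 : y ≠ 0)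
    (hy : y ∈ Submodule.span 𝕜 (Set.range u)) (hPy : P.proj (Set.Ioo Ea Eb) y = 0) :
    (specMeasure P u).real (Set.Ici Eb) = upperGap P Eb u ∧
      (specMeasure P u).real (Set.Iic Ea) = lowerGap P Ea u := by
  obtain ⟨x, hx, hxy⟩ := isCoercive_gramEig u y hy
  have hsplit := P.norm_sq_compl (S := Set.Ioo Ea Eb) measurableSet_Ioo y
  rw [hPy, norm_sq_compl_Ioo P hE, norm_zero] at hsplit
  have h1 := norm_sq_sum_le (restrictTo P (Set.Iic Ea) u) x
  have h2 := norm_sq_sum_le (restrictTo P (Set.Ici Eb) u) x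
  rw [proj_sum, ← hx] at h1 h2
  have hx0 : 0 < ∑ l, ‖x l‖ ^ 2 := by
    refine (Finset.sum_nonneg fun l _ => by positivity).lt_of_ne' fun h0 => hy0 ?_
    have h3 := norm_sum_smul_sq_le x u
    rw [← hx, h0, zero_mul] at h3
    simpa using le_antisymm h3 (by positivity)
  -- All of `‖y‖²` lies in the two tails.
  have hle : gramEig 𝕜 u (gramRank 𝕜 u) ≤ gramEig 𝕜 (restrictTo P (Set.Iic Ea) u) 1 +
      gramEig 𝕜 (restrictTo P (Set.Ici Eb) u) 1 := by
    refine le_of_mul_le_mul_right ?_ hx0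
    linarith
  have h4 := gramEig_one_le_sum (𝕜 := 𝕜) (restrictTo P (Set.Iic Ea) u)
  have h5 := gramEig_one_le_sum (𝕜 := 𝕜) (restrictTo P (Set.Ici Eb) u)
  rw [← specMeasure_real_eq_sum measurableSet_Iic] at h4
  rw [← specMeasure_real_eq_sum measurableSet_Ici] at h5
  unfold upperGap lowerGap at *
  -- The inequalities close up into a cycle: upper trace ≤ upper gap ≤ lower tail eigenvalue ≤ lower
  -- trace ≤ lower gap ≤ upper tail eigenvalue ≤ upper trace.
  constructor <;> linarith

theorem setIntegral_specMeasure_sub (hP : IsSpectralResolution H P) (v : Fin M → H.domain)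
    (S : Set ℝ) (c : ℝ) :
    ∫ E in S, (E - c) ∂specMeasure P (fun l => (v l : ℋ)) =
      ∫ E in S, (E - 0) ∂specMeasure P (fun l => (v l : ℋ)) -
        c * (specMeasure P fun l => (v l : ℋ)).real S := by
  have h := (integrable_specMeasure hP v 0).restrict (s := S)
  simp only [sub_zero] at h ⊢
  rw [integral_sub h (integrable_const c), setIntegral_const, smul_eq_mul, mul_comm c]

theorem IsCertifiable.genEig_sub_bounds (hH : IsSelfAdjoint H) (hP : IsSpectralResolution H P)
    (hE : Ea < Eb) {v : Fin M → H.domain} (hcert : IsCertifiable P Ea Eb fun l => (v l : ℋ))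
    {i : ℕ} (hi : i < gramRank 𝕜 fun l => (v l : ℋ)) :
    genEig hH v (i + 1) - genEig hH (signal hP Ea Eb v) (i + 1) ≤
        (∫ E in Set.Ici Eb, (E - genEig hH (signal hP Ea Eb v) (i + 1))
          ∂specMeasure P (fun l => (v l : ℋ))) / upperGap P Eb (fun l => (v l : ℋ)) ∧
      (∫ E in Set.Iic Ea, (E - genEig hH (signal hP Ea Eb v) (i + 1))
          ∂specMeasure P (fun l => (v l : ℋ))) / lowerGap P Ea (fun l => (v l : ℋ)) ≤
        genEig hH v (i + 1) - genEig hH (signal hP Ea Eb v) (i + 1) := by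
  have hm : 1 ≤ gramRank 𝕜 fun l => (v l : ℋ) := by omega
  obtain ⟨hup0, hup⟩ := gap_pos_of_quotient_mem measurableSet_Ici hm hcert.upper_ne hcert.upper_mem
  obtain ⟨hlo0, hlo⟩ := gap_pos_of_quotient_mem measurableSet_Iic hm hcert.lower_ne hcert.lower_mem
  change 0 < upperGap P Eb _ at hup0
  change 0 < lowerGap P Ea _ at hlo0
  have hupg : upperGap P Eb (fun l => (v l : ℋ)) ≤ gramEig 𝕜 _ (gramRank 𝕜 fun l => (v l : ℋ)) :=
    sub_le_self _ (gramEig_nonneg _ _)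
  have hlog : lowerGap P Ea (fun l => (v l : ℋ)) ≤ gramEig 𝕜 _ (gramRank 𝕜 fun l => (v l : ℋ)) :=
    sub_le_self _ (gramEig_nonneg _ _)
  have hg := (gramEig_gramRank_pos (𝕜 := 𝕜) _ hm)
  have hco := isCoercive_gramEig (𝕜 := 𝕜) fun l => (v l : ℋ)
  obtain ⟨μ, e, he, hμ, hes⟩ := exists_isRitzFamily hH v
  obtain ⟨ν, w, hw, hν, hws⟩ := exists_isRitzFamily hH (signal hP Ea Eb v)
  have hrn : gramRank 𝕜 (fun l => (signal hP Ea Eb v l : ℋ)) ≤ gramRank 𝕜 fun l => (v l : ℋ) :=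
    gramRank_restrictTo_le (Set.Ioo Ea Eb) _
  have hev : ∀ i, (e i : ℋ) ∈ Submodule.span 𝕜 (Set.range fun l => (v l : ℋ)) := fun i =>
    hes ▸ Submodule.subset_span ⟨i, rfl⟩
  have hwP : ∀ j, P.proj (Set.Ioo Ea Eb) (w j : ℋ) = w j := fun j =>
    proj_eq_self_of_mem_span measurableSet_Ioo (fun l => (v l : ℋ)) (by
      have h : (w j : ℋ) ∈ Submodule.span 𝕜 (Set.range fun i => (w i : ℋ)) :=
        Submodule.subset_span ⟨j, rfl⟩
      rw [hws] at h
      exact h)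
  have hvw : ∀ y ∈ Submodule.span 𝕜 (Set.range fun l => (v l : ℋ)),
      P.proj (Set.Ioo Ea Eb) y ∈ Submodule.span 𝕜 (Set.range fun j => (w j : ℋ)) := by
    intro y hy
    rw [hws]
    exact proj_mem_span (Set.Ioo Ea Eb) _ hy
  rw [hμ ⟨i, hi⟩]
  by_cases hir : i < gramRank 𝕜 (fun l => (signal hP Ea Eb v l : ℋ))
  · rw [hν ⟨i, hir⟩]
    have hc := hw.mem_Icc hP hwP ⟨i, hir⟩
    have h1 := mul_ritz_sub_le hP hE he hev hw hwP hvw hg.le hco ⟨i, hi⟩ hc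
      fun j hj => hw.antitone (Fin.le_def.2 hj)
    have h2 := le_mul_ritz_sub hP hE he hev hw hwP hvw hg.le hco hrn ⟨i, hi⟩ hc
      fun j hj => hw.antitone (Fin.le_def.2 hj)
    -- The integrals have a definite sign, so replacing the smallest nonzero Gram eigenvalue by the
    -- smaller gap weakens both bounds.
    have h3 : 0 ≤ ∫ E in Set.Ici Eb, (E - ν ⟨i, hir⟩) ∂specMeasure P (fun l => (v l : ℋ)) :=
      setIntegral_nonneg measurableSet_Ici fun E hE => sub_nonneg.2 (hc.2.trans hE)
    have h4 : ∫ E in Set.Iic Ea, (E - ν ⟨i, hir⟩) ∂specMeasure P (fun l => (v l : ℋ)) ≤ 0 :=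
      setIntegral_nonpos measurableSet_Iic fun E hE => sub_nonpos.2 (hE.trans hc.1)
    constructor
    · refine le_trans ?_ (div_le_div_of_nonneg_left h3 hup0 hupg)
      rwa [le_div_iff₀ hg, mul_comm]
    · rw [← neg_le_neg_iff, ← neg_div]
      refine le_trans ?_ (div_le_div_of_nonneg_left (neg_nonneg.2 h4) hlo0 hlog)
      rw [le_div_iff₀ hg]
      linarith
  · have hzero : genEig hH (signal hP Ea Eb v) (i + 1) = 0 := by
      rw [genEig, dif_neg (by omega)]
    -- Rank deficiency of the signal part: some nonzero guess combination is orthogonal to all of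
    -- `w`, hence annihilated by the projection.
    obtain ⟨a, -, hy0, hort⟩ := he.exists_orthogonal (fun j => (w j : ℋ)) Finset.univ Finset.univ
      (by rw [Finset.card_fin, Finset.card_fin]; omega)
    have hy : ∑ i, a i • (e i : ℋ) ∈ Submodule.span 𝕜 (Set.range fun l => (v l : ℋ)) :=
      Submodule.sum_mem _ fun i _ => Submodule.smul_mem _ _ (hev i)
    have hPy : P.proj (Set.Ioo Ea Eb) (∑ i, a i • (e i : ℋ)) = 0 := by
      rw [hw.eq_sum_of_mem_span (hvw _ hy)]
      refine Finset.sum_eq_zero fun j _ => ?_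
      rw [← P.inner_proj measurableSet_Ioo, hwP, hort j (Finset.mem_univ j), zero_smul]
    obtain ⟨hup1, hlo1⟩ := gap_eq_of_proj_eq_zero hE hup hlo hy0 hy hPy
    -- With `c` at an endpoint the condition on `ν` holds for every `j`, and the gap itself serves
    -- as coercivity constant.
    have h1 := mul_ritz_sub_le hP hE he hev hw hwP hvw hup0.le
      (fun y hy => (hco y hy).imp fun x hx => ⟨hx.1, le_trans
        (mul_le_mul_of_nonneg_right hupg (Finset.sum_nonneg fun l _ => by positivity)) hx.2⟩)
      ⟨i, hi⟩ (Set.right_mem_Icc.2 hE.le) fun j _ => (hw.mem_Icc hP hwP j).2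
    have h2 := le_mul_ritz_sub hP hE he hev hw hwP hvw hlo0.le
      (fun y hy => (hco y hy).imp fun x hx => ⟨hx.1, le_trans
        (mul_le_mul_of_nonneg_right hlog (Finset.sum_nonneg fun l _ => by positivity)) hx.2⟩)
      hrn ⟨i, hi⟩ (Set.left_mem_Icc.2 hE.le) fun j _ => (hw.mem_Icc hP hwP j).1
    -- Since the tail trace equals the gap, `c` times the gap appears on both sides and cancels,
    -- leaving the bound with `μ_i(B) = 0`.
    rw [setIntegral_specMeasure_sub hP, hup1] at h1
    rw [setIntegral_specMeasure_sub hP, hlo1] at h2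
    rw [hzero, le_div_iff₀ hup0, div_le_iff₀ hlo0]
    constructor <;> linarith

/-! ### The refined guess vectors. -/

section Refined

variable {v : Fin M → H.domain} {U : Matrix (Fin M) (Fin M) 𝕜} {ε : ℝ}

theorem coe_refined (v : Fin M → H.domain) (U : Matrix (Fin M) (Fin M) 𝕜) (ε : ℝ)
    (j : Fin (detectedDim 𝕜 (fun l => (v l : ℋ)) ε)) :
    (refined v U ε j : ℋ) = ∑ l, U l (Fin.castLE (detectedDim_le _ _) j) • (v l : ℋ) :=
  IsRitzFamily.coe_sum _

theorem Diagonalizes.inner_refined (hU : Diagonalizes (fun l => (v l : ℋ)) U)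
    (i j : Fin (detectedDim 𝕜 (fun l => (v l : ℋ)) ε)) :
    inner 𝕜 (refined v U ε i : ℋ) (refined v U ε j : ℋ) =
      if i = j then ((gramEig 𝕜 (fun l => (v l : ℋ)) (i + 1) : ℝ) : 𝕜) else 0 := by
  have h := congrFun (congrFun hU.2 (Fin.castLE (detectedDim_le _ _) i))
    (Fin.castLE (detectedDim_le _ _) j)
  rw [coe_refined, coe_refined, ← star_dotProduct_gram]
  rw [Matrix.mul_assoc, Matrix.diagonal_apply] at h
  simp only [Fin.castLE_inj, Fin.val_castLE] at h
  rw [← h]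
  simp [Matrix.mul_apply, dotProduct, mulVec, conjTranspose_apply]

theorem Diagonalizes.norm_sq_sum_refined (hU : Diagonalizes (fun l => (v l : ℋ)) U)
    (x : Fin (detectedDim 𝕜 (fun l => (v l : ℋ)) ε) → 𝕜) :
    ‖∑ j, x j • (refined v U ε j : ℋ)‖ ^ 2 =
      ∑ j : Fin (detectedDim 𝕜 (fun l => (v l : ℋ)) ε),
        gramEig 𝕜 (fun l => (v l : ℋ)) (j + 1) * ‖x j‖ ^ 2 := by
  rw [← inner_self_eq_norm_sq (𝕜 := 𝕜), sum_inner, map_sum]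
  refine Finset.sum_congr rfl fun j _ => ?_
  rw [inner_smul_left, inner_sum]
  simp only [inner_smul_right, hU.inner_refined, mul_ite, mul_zero, Finset.sum_ite_eq,
    Finset.mem_univ, if_true]
  rw [← mul_assoc, RCLike.conj_mul, ← RCLike.ofReal_pow, ← RCLike.ofReal_mul, RCLike.ofReal_re,
    mul_comm]

theorem gramEig_detectedDim_le (u : Fin M → ℋ) (j : Fin (detectedDim 𝕜 u ε)) :
    gramEig 𝕜 u (detectedDim 𝕜 u ε) ≤ gramEig 𝕜 u (j + 1) := by
  obtain ⟨k, hk, hk'⟩ := gramEig_of_le (𝕜 := 𝕜) u j.pos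
    (detectedDim_le _ _)
  rw [hk']
  exact gramEig_antitone u (show Fin.castLE (detectedDim_le _ _) j ≤ k from
    Fin.le_def.2 (by simp; omega))

theorem le_gramEig_detectedDim (u : Fin M → ℋ) (h : 1 ≤ detectedDim 𝕜 u ε) :
    ε ≤ gramEig 𝕜 u (detectedDim 𝕜 u ε) := by
  obtain ⟨k, hk, hk'⟩ := gramEig_of_le (𝕜 := 𝕜) u h (detectedDim_le _ _)
  rw [hk']
  exact (lt_detectedDim_iff u ε k).1 (by omega)

theorem Diagonalizes.isCoercive_refined (hU : Diagonalizes (fun l => (v l : ℋ)) U) {g : ℝ}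
    (hg : g ≤ gramEig 𝕜 (fun l => (v l : ℋ)) (detectedDim 𝕜 (fun l => (v l : ℋ)) ε)) :
    IsCoercive 𝕜 (fun j => (refined v U ε j : ℋ)) g := by
  intro y hy
  rw [← Fintype.range_linearCombination] at hy
  obtain ⟨x, rfl⟩ := hy
  rw [Fintype.linearCombination_apply]
  refine ⟨x, rfl, ?_⟩
  rw [hU.norm_sq_sum_refined, Finset.mul_sum]
  exact Finset.sum_le_sum fun j _ =>
    mul_le_mul_of_nonneg_right (hg.trans (gramEig_detectedDim_le _ j)) (by positivity)

/-- The refined vectors are orthogonal with squared norms at least `ε > 0`. -/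
theorem Diagonalizes.gramRank_refined (hU : Diagonalizes (fun l => (v l : ℋ)) U) (hε : 0 < ε) :
    gramRank 𝕜 (fun j => (refined v U ε j : ℋ)) = detectedDim 𝕜 (fun l => (v l : ℋ)) ε := by
  have hli : LinearIndependent 𝕜 (fun j => (refined v U ε j : ℋ)) := by
    rw [Fintype.linearIndependent_iff]
    intro x hx j
    have h := hU.norm_sq_sum_refined x
    rw [hx, norm_zero, zero_pow two_ne_zero] at h
    have h2 := (Finset.sum_eq_zero_iff_of_nonneg
      (fun j _ => mul_nonneg (gramEig_nonneg _ _) (by positivity))).1 h.symm j (Finset.mem_univ j)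
    have h3 : 0 < gramEig 𝕜 (fun l => (v l : ℋ)) (j + 1) :=
      hε.trans_le ((lt_detectedDim_iff _ ε (Fin.castLE (detectedDim_le _ _) j)).1 j.2)
    simpa using (mul_eq_zero.1 h2).resolve_left h3.ne'
  rw [gramRank_eq, finrank_span_eq_card hli, Fintype.card_fin]

theorem Diagonalizes.sum_norm_sq_col {u : Fin M → ℋ} (hU : Diagonalizes u U) (j : Fin M) :
    ∑ l, ‖U l j‖ ^ 2 = 1 := by
  have h := congrFun (congrFun (Matrix.mem_unitaryGroup_iff'.1 hU.1) j) j
  rw [Matrix.mul_apply, Matrix.one_apply_eq] at h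
  apply RCLike.ofReal_injective (K := 𝕜)
  rw [RCLike.ofReal_one, ← h, RCLike.ofReal_sum]
  refine Finset.sum_congr rfl fun l _ => ?_
  rw [Matrix.star_apply, RCLike.star_def, RCLike.conj_mul, RCLike.ofReal_pow]

/-- A refined noise vector is the original noise applied to a unit column of `U`. -/
theorem Diagonalizes.norm_sq_noise_refined_le (hU : Diagonalizes (fun l => (v l : ℋ)) U)
    (j : Fin (detectedDim 𝕜 (fun l => (v l : ℋ)) ε)) :
    ‖noise P Ea Eb (fun j => (refined v U ε j : ℋ)) j‖ ^ 2 ≤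
      gramEig 𝕜 (noise P Ea Eb fun l => (v l : ℋ)) 1 := by
  have h := norm_sq_sum_le (noise P Ea Eb fun l => (v l : ℋ))
    fun l => U l (Fin.castLE (detectedDim_le _ _) j)
  rw [hU.sum_norm_sq_col, mul_one, noise_eq, proj_sum, ← coe_refined] at h
  rw [noise_eq, noise_eq]
  exact h

theorem specMeasure_add_eq (P : ProjValuedMeasure 𝕜 ℋ) (hE : Ea < Eb) (u : Fin M → ℋ) :
    (specMeasure P u).real (Set.Iic Ea) + (specMeasure P u).real (Set.Ici Eb) =
      ∑ l, ‖noise P Ea Eb u l‖ ^ 2 := by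
  rw [specMeasure_real_apply u measurableSet_Iic, specMeasure_real_apply u measurableSet_Ici,
    ← Finset.sum_add_distrib, noise_eq]
  exact Finset.sum_congr rfl fun l _ => (norm_sq_compl_Ioo P hE (u l)).symm

theorem trace_gram (u : Fin M → ℋ) : (gram 𝕜 u).trace = ((∑ l, ‖u l‖ ^ 2 : ℝ) : 𝕜) := by
  simp [Matrix.trace, gram_apply, inner_self_eq_norm_sq_to_K]

/-- The comparison family is `φ`, which exhausts the spectral subspace by its dimension. The
coercivity constant `λ_d(V²)` is lowered to the stated denominator, positive because `λ_d(V²) ≥ ε >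
λ_1(N²)`. -/
theorem Diagonalizes.genEig_refined_bounds (hH : IsSelfAdjoint H) (hP : IsSpectralResolution H P)
    (hE : Ea < Eb) (hU : Diagonalizes (fun l => (v l : ℋ)) U)
    (hε : gramEig 𝕜 (noise P Ea Eb fun l => (v l : ℋ)) 1 < ε)
    (hran : eigenSubspace H Ea Eb = (P.proj (Set.Ioo Ea Eb)).range) {d : ℕ}
    (hd : d = detectedDim 𝕜 (fun l => (v l : ℋ)) ε)
    (hdim : d = Module.finrank 𝕜 (eigenSubspace H Ea Eb))
    {φ : Fin d → H.domain} {lam : Fin d → ℝ} (hφ : Orthonormal 𝕜 fun i => (φ i : ℋ))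
    (hHφ : ∀ i, H (φ i) = (lam i : 𝕜) • (φ i : ℋ)) (hlam : ∀ i, lam i ∈ Set.Ioo Ea Eb)
    (hanti : Antitone lam) (i : Fin d) :
    genEig hH (refined v U ε) (i + 1) - lam i ≤
        (∫ E in Set.Ici Eb, (E - lam i) ∂specMeasure P (fun j => (refined v U ε j : ℋ))) /
          (gramEig 𝕜 (fun l => (v l : ℋ)) d -
            gramEig 𝕜 (noise P Ea Eb (fun l => (v l : ℋ))) 1) ∧
      (∫ E in Set.Iic Ea, (E - lam i) ∂specMeasure P (fun j => (refined v U ε j : ℋ))) /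
          (gramEig 𝕜 (fun l => (v l : ℋ)) d -
            gramEig 𝕜 (noise P Ea Eb (fun l => (v l : ℋ))) 1) ≤
        genEig hH (refined v U ε) (i + 1) - lam i := by
  have hN : 0 ≤ gramEig 𝕜 (noise P Ea Eb (fun l => (v l : ℋ))) 1 := gramEig_nonneg _ _
  have hd1 : 1 ≤ d := i.pos
  have hεd : ε ≤ gramEig 𝕜 (fun l => (v l : ℋ)) d := by
    rw [hd]
    exact le_gramEig_detectedDim _ (hd ▸ hd1)
  have hg : 0 < gramEig 𝕜 (fun l => (v l : ℋ)) d -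
      gramEig 𝕜 (noise P Ea Eb (fun l => (v l : ℋ))) 1 := by linarith
  have hco := hU.isCoercive_refined (ε := ε) (g := gramEig 𝕜 (fun l => (v l : ℋ)) d -
      gramEig 𝕜 (noise P Ea Eb (fun l => (v l : ℋ))) 1) (by rw [← hd]; linarith)
  have hrank := hU.gramRank_refined (ε := ε) (by linarith)
  obtain ⟨μ, e, he, hμ, hes⟩ := exists_isRitzFamily hH (refined v U ε)
  have hev : ∀ i, (e i : ℋ) ∈ Submodule.span 𝕜 (Set.range fun j => (refined v U ε j : ℋ)) :=
    fun i => hes ▸ Submodule.subset_span ⟨i, rfl⟩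
  have hw : IsRitzFamily H φ lam := by
    refine ⟨hφ, fun i j => ?_, hanti⟩
    rw [hHφ, inner_smul_right, orthonormal_iff_ite.1 hφ i j]
    split_ifs <;> simp
  have hφmem : ∀ j, (φ j : ℋ) ∈ eigenSubspace H Ea Eb := fun j =>
    Submodule.subset_span ⟨φ j, lam j, hlam j, hHφ j, rfl⟩
  have hφP : ∀ j, P.proj (Set.Ioo Ea Eb) (φ j : ℋ) = φ j := by
    intro j
    have h := hφmem j
    rw [hran] at h
    obtain ⟨z, hz⟩ := h
    rw [← hz]
    exact P.proj_idem measurableSet_Ioo z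
  have hspan : Submodule.span 𝕜 (Set.range fun j => (φ j : ℋ)) = eigenSubspace H Ea Eb := by
    -- `finrank` is zero in infinite dimension, which `d ≥ 1` rules out.
    have : FiniteDimensional 𝕜 (eigenSubspace H Ea Eb) :=
      FiniteDimensional.of_finrank_pos (by omega)
    refine Submodule.eq_of_le_of_finrank_eq ?_ ?_
    · rw [Submodule.span_le]
      rintro _ ⟨j, rfl⟩
      exact hφmem j
    · rw [finrank_span_eq_card hφ.linearIndependent, Fintype.card_fin, ← hdim]
  have hvw : ∀ y ∈ Submodule.span 𝕜 (Set.range fun j => (refined v U ε j : ℋ)),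
      P.proj (Set.Ioo Ea Eb) y ∈ Submodule.span 𝕜 (Set.range fun j => (φ j : ℋ)) := by
    intro y _
    rw [hspan, hran]
    exact ⟨y, rfl⟩
  have hi : (i : ℕ) < gramRank 𝕜 fun j => (refined v U ε j : ℋ) := by
    rw [hrank, ← hd]
    exact i.2
  have h1 := mul_ritz_sub_le hP hE he hev hw hφP hvw hg.le hco ⟨i, hi⟩
    (Set.Ioo_subset_Icc_self (hlam i)) fun j hj => hanti (Fin.le_def.2 hj)
  have h2 := le_mul_ritz_sub hP hE he hev hw hφP hvw hg.le hco (by rw [hrank, ← hd]) ⟨i, hi⟩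
    (Set.Ioo_subset_Icc_self (hlam i)) fun j hj => hanti (Fin.le_def.2 hj)
  rw [hμ ⟨i, hi⟩, le_div_iff₀ hg, div_le_iff₀ hg]
  constructor <;> linarith

end Refined

end GEP

theorem mainTheorem8 {𝕜 ℋ : Type*} [RCLike 𝕜] [NormedAddCommGroup ℋ] [InnerProductSpace 𝕜 ℋ]
    [CompleteSpace ℋ] (H : ℋ →ₗ.[𝕜] ℋ) (hH : IsSelfAdjoint H)
    (P : GEP.ProjValuedMeasure 𝕜 ℋ) (hP : GEP.IsSpectralResolution H P)
    (Ea Eb : ℝ) (hE : Ea < Eb) {M : ℕ} (v : Fin M → H.domain) :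
    -- the integrated spectral inequalities for a certifiable signal
    (GEP.IsCertifiable P Ea Eb (fun l => (v l : ℋ)) →
      ∀ i : ℕ, 1 ≤ i → i ≤ GEP.gramRank 𝕜 (fun l => (v l : ℋ)) →
        MeasureTheory.IntegrableOn (fun E => E - GEP.genEig hH (GEP.signal hP Ea Eb v) i)
          (Set.Ici Eb) (GEP.specMeasure P (fun l => (v l : ℋ))) ∧
        MeasureTheory.IntegrableOn (fun E => E - GEP.genEig hH (GEP.signal hP Ea Eb v) i)
          (Set.Iic Ea) (GEP.specMeasure P (fun l => (v l : ℋ))) ∧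
        GEP.genEig hH v i - GEP.genEig hH (GEP.signal hP Ea Eb v) i ≤
          (∫ E in Set.Ici Eb, (E - GEP.genEig hH (GEP.signal hP Ea Eb v) i)
            ∂GEP.specMeasure P (fun l => (v l : ℋ))) /
            (GEP.gramEig 𝕜 (fun l => (v l : ℋ)) (GEP.gramRank 𝕜 (fun l => (v l : ℋ))) -
              GEP.gramEig 𝕜 (GEP.restrictTo P (Set.Ici Eb) (fun l => (v l : ℋ))) 1) ∧
        (∫ E in Set.Iic Ea, (E - GEP.genEig hH (GEP.signal hP Ea Eb v) i)
            ∂GEP.specMeasure P (fun l => (v l : ℋ))) /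
            (GEP.gramEig 𝕜 (fun l => (v l : ℋ)) (GEP.gramRank 𝕜 (fun l => (v l : ℋ))) -
              GEP.gramEig 𝕜 (GEP.restrictTo P (Set.Iic Ea) (fun l => (v l : ℋ))) 1) ≤
          GEP.genEig hH v i - GEP.genEig hH (GEP.signal hP Ea Eb v) i) ∧
    -- the sufficient condition for being a certifiable signal
    (v ≠ 0 →
      ((GEP.gramRank 𝕜 (fun l => (v l : ℋ)) : ℝ) + 1) *
          GEP.gramEig 𝕜 (GEP.noise P Ea Eb (fun l => (v l : ℋ))) 1 ≤
        GEP.gramEig 𝕜 (fun l => (v l : ℋ)) (GEP.gramRank 𝕜 (fun l => (v l : ℋ))) →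
      GEP.IsCertifiable P Ea Eb (fun l => (v l : ℋ))) ∧
    -- the guarantee for the refined guess vectors
    (∀ (ε : ℝ) (U : Matrix (Fin M) (Fin M) 𝕜) (m : ℕ),
      GEP.gramEig 𝕜 (GEP.noise P Ea Eb (fun l => (v l : ℋ))) 1 < ε →
      GEP.Diagonalizes (fun l => (v l : ℋ)) U →
      GEP.eigenSubspace H Ea Eb = (P.proj (Set.Ioo Ea Eb)).range →
      m = GEP.detectedDim 𝕜 (fun l => (v l : ℋ)) ε →
      m = Module.finrank 𝕜 (GEP.eigenSubspace H Ea Eb) →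
      ((m : ℝ) + 1) * GEP.gramEig 𝕜 (GEP.noise P Ea Eb (fun l => (v l : ℋ))) 1 ≤
        GEP.gramEig 𝕜 (fun l => (v l : ℋ)) m →
      (∀ (φ : Fin m → H.domain) (lam : Fin m → ℝ),
        Orthonormal 𝕜 (fun i => (φ i : ℋ)) →
        (∀ i, H (φ i) = (lam i : 𝕜) • (φ i : ℋ)) →
        (∀ i, lam i ∈ Set.Ioo Ea Eb) → Antitone lam →
        ∀ i : Fin m,
          MeasureTheory.IntegrableOn (fun E => E - lam i) (Set.Ici Eb)
            (GEP.specMeasure P (fun j => (GEP.refined v U ε j : ℋ))) ∧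
          MeasureTheory.IntegrableOn (fun E => E - lam i) (Set.Iic Ea)
            (GEP.specMeasure P (fun j => (GEP.refined v U ε j : ℋ))) ∧
          GEP.genEig hH (GEP.refined v U ε) (i + 1) - lam i ≤
            (∫ E in Set.Ici Eb, (E - lam i)
              ∂GEP.specMeasure P (fun j => (GEP.refined v U ε j : ℋ))) /
              (GEP.gramEig 𝕜 (fun l => (v l : ℋ)) m -
                GEP.gramEig 𝕜 (GEP.noise P Ea Eb (fun l => (v l : ℋ))) 1) ∧
          (∫ E in Set.Iic Ea, (E - lam i)
              ∂GEP.specMeasure P (fun j => (GEP.refined v U ε j : ℋ))) /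
              (GEP.gramEig 𝕜 (fun l => (v l : ℋ)) m -
                GEP.gramEig 𝕜 (GEP.noise P Ea Eb (fun l => (v l : ℋ))) 1) ≤
            GEP.genEig hH (GEP.refined v U ε) (i + 1) - lam i) ∧
      (((GEP.specMeasure P (fun j => (GEP.refined v U ε j : ℋ))).real (Set.Iic Ea) +
          (GEP.specMeasure P (fun j => (GEP.refined v U ε j : ℋ))).real (Set.Ici Eb) : ℝ) : 𝕜) =
        (Matrix.gram 𝕜
          (GEP.noise P Ea Eb (fun j => (GEP.refined v U ε j : ℋ)))).trace ∧
      (GEP.specMeasure P (fun j => (GEP.refined v U ε j : ℋ))).real (Set.Iic Ea) +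
          (GEP.specMeasure P (fun j => (GEP.refined v U ε j : ℋ))).real (Set.Ici Eb) ≤
        m * GEP.gramEig 𝕜 (GEP.noise P Ea Eb (fun l => (v l : ℋ))) 1) := by
  refine ⟨fun hcert i hi1 hi => ?_, fun hv hnoise => ?_, ?_⟩
  · obtain ⟨k, rfl⟩ : ∃ k, i = k + 1 := ⟨i - 1, by omega⟩
    exact ⟨(GEP.integrable_specMeasure hP v _).integrableOn,
      (GEP.integrable_specMeasure hP v _).integrableOn,
      hcert.genEig_sub_bounds hH hP hE (by omega)⟩
  · refine GEP.isCertifiable_of_noise_le P ?_ hnoise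
    obtain ⟨l, hl⟩ := Function.ne_iff.1 hv
    -- The combination picking out the nonzero vector `v l`.
    refine GEP.one_le_gramRank _ (x := Pi.single l 1) ?_
    simpa [Pi.single_apply, ite_smul] using hl
  · intro ε U m hε hU hran hd hdim _
    refine ⟨fun φ lam hφ hHφ hlam hanti i => ⟨(GEP.integrable_specMeasure hP _ _).integrableOn,
      (GEP.integrable_specMeasure hP _ _).integrableOn,
      hU.genEig_refined_bounds hH hP hE hε hran hd hdim hφ hHφ hlam hanti i⟩, ?_, ?_⟩
    · rw [GEP.trace_gram, GEP.specMeasure_add_eq P hE]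
    · rw [GEP.specMeasure_add_eq P hE, hd]
      refine (Finset.sum_le_card_nsmul _ _ _ fun j _ => hU.norm_sq_noise_refined_le j).trans_eq ?_
      rw [Finset.card_fin, nsmul_eq_mul]
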